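/- Let $SU(3)$ act on $\mathfrak{su}(3)$ by conjugation, let $\langle X,Y\rangle=\mathrm{tr}(X^\dagger Y)$, let $E_j=i\lambda_j/\sqrt2$ ($j=1,\dots,8$, $\lambda_j$ the Gell-Mann matrices) be the standard orthonormal basis of $\mathfrak{su}(3)$ with coordinates $x_1,\dots,x_8$ and structure constants $[E_k,E_j]=\sum_l c^l_{kj}E_l$, and let $\varpi_1=\tfrac1{\sqrt2}E_3+\tfrac1{\sqrt6}E_8$, $\varpi_2=\sqrt{2/3}\,E_8$. Dominant weights are $\omega_{(p,q)}=p\varpi_1+q\varpi_2$ with $p,q\in\mathbb N_0$. Let $\xi\in\mathfrak{su}(3)$ be a unit vector that is a positive multiple of a nonzero dominant weight, let $r(\xi)$ be the least $R>0$ such that $R\xi$ is a dominant weight, and write $r(\xi)\xi=\omega_{(p_1,q_1)}$. Let $\mathcal O_\xi$ be the orbit of $\xi$, with the invariant probability measure induced by Haar measure, the inner product $\langle f_1,f_2\rangle_\xi=\int_{\mathcal O_\xi}\overline{f_1}f_2$ and the supremum norm $\|\cdot\|_\xi$; let $Poly(\mathcal O_\xi)$ be the algebra of restrictions to $\mathcal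 O_\xi$ of complex polynomials on $\mathfrak{su}(3)$, with the Poisson bracket $\{\cdot,\cdot\}$ obtained by restricting $\{P,Q\}=\sum_{j,k,l}c^l_{kj}\,x_l\,\partial_jP\,\partial_kQ$. For $s\in\mathbb N=\{1,2,\dots\}$ let $\mathcal H_s$ be a unitary irreducible representation of $SU(3)$ with highest weight $s\,\omega_{(p_1,q_1)}$, and let $W^s:\mathcal B(\mathcal H_s)\to Poly(\mathcal O_\xi)$ be a symbol correspondence, that is, an injective linear $SU(3)$-equivariant map with $W^s_{A^\dagger}=\overline{W^s_A}$ and $\int_{\mathcal O_\xi}W^s_A=\mathrm{tr}(A)/\dim\mathcal H_s$. Let $\star^s$ be the product on the image of $W^s$ given by $W^s_A\star^sW^s_B=W^s_{AB}$. (Every $f\in Poly(\mathcal O_\xi)$ lies in the image of $W^s$ for all large $s$.) Assume that $(W^s)_{s}$ is of Poisson type: for all $f_1,f_2\in Poly(\mathcal O_\xi)$, $$\lim_{s\to\infty}\|f_1\star^sf_2-f_1f_2\|_\xi=0,\qquad \lim_{s\to\infty}\big\|s\,r(\xi)\,(f_1\star^sf_2-f_2\star^sf_1)-i\{f_1,f_2\}\big\|_\xi=0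 .$$ Let $\boldsymbol a=(a,b)\in\mathbb N_0^2$ and let $K$ be a unitary irreducible representation with highest weight $\omega_{(a,b)}$. For each $s$ let $e^s_1,\dots,e^s_{n_s}:K\to\mathcal B(\mathcal H_s)$ be isometric intertwiners (for the inner product $\mathrm{tr}(A^\dagger B)$) with pairwise orthogonal ranges whose sum is the $\boldsymbol a$-isotypic component of $\mathcal B(\mathcal H_s)$, and let $X_1,\dots,X_m:K\to Poly(\mathcal O_\xi)$ be isometric intertwiners (for $\langle\cdot,\cdot\rangle_\xi$) with pairwise orthogonal ranges whose sum is the $\boldsymbol a$-isotypic component of $Poly(\mathcal O_\xi)$. The characteristic matrix $\mathbf C^s_\xi(\boldsymbol a)$ of $W^s$ is the $m\times n_s$ matrix whose $(\gamma,\sigma)$ entry is $\big\langle X_\gamma(k),\,W^s(\sqrt{\dim\mathcal H_s}\;e^s_\sigma(k))\big\rangle_\xi$ for a unit vector $k\in K$ (it does not depend on $k$); equivalently, $W^s(\sqrt{\dim\mathcal H_s}\,e^s_\sigma(k))=\sum_\gamma \mathbf C^s_\xi(\boldsymbol a)_{\gamma\sigma}X_\gamma(k)$ for all $k\in K$. Then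 $n_s=m$ for all sufficiently large $s$, and $$\lim_{s\to\infty}\big(\mathbf C^s_\xi(\boldsymbol a)\big)^\dagger\,\mathbf C^s_\xi(\boldsymbol a)=\mathbf 1 .$$ -/

import Mathlib

open MeasureTheory Filter Topology
open scoped Matrix

namespace QuarkSystems

noncomputable section

/-! ### The group `SU(3)` and its normalized Haar measure -/

/-- The group `SU(3)`. -/
abbrev SU3 : Type := ↥(Matrix.specialUnitaryGroup (Fin 3) ℂ)

/-- Complex `3 × 3` matrices. -/
abbrev Mat3 : Type := Matrix (Fin 3) (Fin 3) ℂ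

instance instIsTopologicalGroupSU3 : IsTopologicalGroup SU3 where
  continuous_inv := by
    refine Continuous.subtype_mk ?_ _
    exact continuous_star.comp continuous_subtype_val

instance instCompactSpaceSU3 : CompactSpace SU3 := by
  have hc : IsCompact (Set.pi Set.univ fun _ : Fin 3 =>
      Set.pi Set.univ fun _ : Fin 3 => Metric.closedBall (0 : ℂ) 1) :=
    isCompact_univ_pi fun _ => isCompact_univ_pi fun _ => isCompact_closedBall 0 1
  have hcl : IsClosed {A : Mat3 | star A * A = 1 ∧ A * star A = 1 ∧ A.det = 1} := by
    refine IsClosed.and (isClosed_eq (by fun_prop) continuous_const)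
      (IsClosed.and (isClosed_eq (by fun_prop) continuous_const)
        (isClosed_eq (Continuous.matrix_det continuous_id) continuous_const))
  refine isCompact_iff_compactSpace.mp (IsCompact.of_isClosed_subset (t :=
    (Matrix.specialUnitaryGroup (Fin 3) ℂ : Set Mat3)) hc ?_ ?_)
  · convert hcl using 1
    ext A
    exact ⟨fun h => ⟨h.1.1, h.1.2, h.2⟩, fun h => ⟨⟨h.1, h.2.1⟩, h.2.2⟩⟩
  · intro A hA i _ j _
    simpa using entry_norm_bound_of_unitary (U := A) hA.1 i j

instance instMeasurableSpaceSU3 : MeasurableSpace SU3 := borel SU3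

instance instBorelSpaceSU3 : BorelSpace SU3 := ⟨rfl⟩

/-- The Haar measure of `SU(3)` of total mass one. -/
def haarSU3 : Measure SU3 := Measure.haarMeasure ⊤

/-! ### The Lie algebra `su(3)`, dominant weights and rational orbits -/

/-- The Gell-Mann matrices `λ₁, …, λ₈` (indexed from `0`). -/
def gellMann : Fin 8 → Mat3 :=
  ![!![0, 1, 0; 1, 0, 0; 0, 0, 0],
    !![0, -Complex.I, 0; Complex.I, 0, 0; 0, 0, 0],
    !![1, 0, 0; 0, -1, 0; 0, 0, 0],
    !![0, 0, 1; 0, 0, 0; 1, 0, 0],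
    !![0, 0, -Complex.I; 0, 0, 0; Complex.I, 0, 0],
    !![0, 0, 0; 0, 0, 1; 0, 1, 0],
    !![0, 0, 0; 0, 0, -Complex.I; 0, Complex.I, 0],
    ((√3 : ℝ) : ℂ)⁻¹ • !![1, 0, 0; 0, 1, 0; 0, 0, -2]]

/-- The basis `E_j = i λ_j / √2` of `su(3)`, orthonormal for `⟨X, Y⟩ = tr (X† Y)`. -/
def E (j : Fin 8) : Mat3 := (Complex.I / ((√2 : ℝ) : ℂ)) • gellMann j

/-- The coordinates `x_j = tr (E_j† X)` of a matrix in the basis `E_j`. -/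
def coord (X : Mat3) (j : Fin 8) : ℂ := ((E j)ᴴ * X).trace

/-- The first fundamental weight, as an element of `su(3)`. -/
def fundWeight₁ : Mat3 := ((1 / √2 : ℝ) : ℂ) • E 2 + ((1 / √6 : ℝ) : ℂ) • E 7

/-- The second fundamental weight, as an element of `su(3)`. -/
def fundWeight₂ : Mat3 := ((√(2 / 3) : ℝ) : ℂ) • E 7

/-- The dominant weight `ω_(p,q) = p ϖ₁ + q ϖ₂`. -/
def domWeight (p q : ℕ) : Mat3 := (p : ℂ) • fundWeight₁ + (q : ℂ) • fundWeight₂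

/-- The positive scalars that turn `ξ` into a dominant weight. -/
def integralScalars (ξ : Mat3) : Set ℝ :=
  {R | 0 < R ∧ ∃ p q : ℕ, (R : ℂ) • ξ = domWeight p q}

/-- The unit vectors of `su(3)` on the ray of a nonzero dominant weight. They
label the rational orbits. -/
def rationalPoints : Set Mat3 :=
  {ξ | (ξᴴ * ξ).trace = 1 ∧ (integralScalars ξ).Nonempty}

/-- The integral radius: the least `R > 0` such that `R ξ` is a dominant weight. -/
def intRadius (ξ : Mat3) : ℝ := sInf (integralScalars ξ)

/-- The adjoint orbit of `ξ`. -/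
def orbit (ξ : Mat3) : Set Mat3 :=
  Set.range fun g : SU3 => (g : Mat3) * ξ * (g : Mat3)ᴴ

/-- The base point moved by `g`, as a point of the orbit. -/
def orbitPoint (ξ : Mat3) (g : SU3) : orbit ξ := ⟨(g : Mat3) * ξ * (g : Mat3)ᴴ, g, rfl⟩

/-- The adjoint action of `SU(3)` on an orbit. -/
def ad (ξ : Mat3) (g : SU3) (x : orbit ξ) : orbit ξ :=
  ⟨(g : Mat3) * (x : Mat3) * (g : Mat3)ᴴ, by
    obtain ⟨_, h, rfl⟩ := x
    exact ⟨g * h, by simp [Matrix.mul_assoc, Matrix.conjTranspose_mul]⟩⟩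

/-! ### Polynomials on an orbit -/

/-- Restriction to the orbit of a complex polynomial in the coordinates `x₁, …, x₈` of `su(3)`. -/
def restrict (ξ : Mat3) : MvPolynomial (Fin 8) ℂ →ₐ[ℂ] (orbit ξ → ℂ) :=
  MvPolynomial.aeval fun j => fun x : orbit ξ => coord (x : Mat3) j

/-- The algebra of polynomial functions on the orbit. -/
def OrbitPoly (ξ : Mat3) : Subalgebra ℂ (orbit ξ → ℂ) := (restrict ξ).range

/-- Restriction of polynomials, as a map into `OrbitPoly ξ`. -/
def toPoly (ξ : Mat3) : MvPolynomial (Fin 8) ℂ →ₐ[ℂ] OrbitPoly ξ := (restrict ξ).rangeRestrict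

/-- The structure constants: `structConst l k j` is the coefficient of `E_l` in `[E_k, E_j]`. -/
def structConst (l k j : Fin 8) : ℂ := coord (E k * E j - E j * E k) l

/-- The Lie–Poisson (KAKS) bracket of polynomials on `su(3)`, given by the bivector
`∑ c^l_{kj} x_l ∂_j ⊗ ∂_k`. Its symplectic leaves are the orbits: the restriction of `{P, Q}` to
an orbit is the symplectic Poisson bracket of the restrictions of `P` and `Q`. -/
def lieBracket (P Q : MvPolynomial (Fin 8) ℂ) : MvPolynomial (Fin 8) ℂ :=
  ∑ j, ∑ k, ∑ l, MvPolynomial.C (structConst l k j) * MvPolynomial.X l *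
    MvPolynomial.pderiv j P * MvPolynomial.pderiv k Q

/-- The supremum norm on the orbit. -/
def supNorm {ξ : Mat3} (f : OrbitPoly ξ) : ℝ := ⨆ x : orbit ξ, ‖(f : orbit ξ → ℂ) x‖

/-- The normalized invariant integral on the orbit. -/
def orbitIntegral {ξ : Mat3} (f : orbit ξ → ℂ) : ℂ := ∫ g, f (orbitPoint ξ g) ∂haarSU3

/-- The inner product of functions on the orbit, conjugate-linear in the first argument. -/
def orbitInner {ξ : Mat3} (f₁ f₂ : OrbitPoly ξ) : ℂ :=
  orbitIntegral fun x : orbit ξ =>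
    (starRingEnd ℂ) ((f₁ : orbit ξ → ℂ) x) * (f₂ : orbit ξ → ℂ) x

/-! ### Quantum quark systems -/

section Representations

variable {H : Type*} [NormedAddCommGroup H] [InnerProductSpace ℂ H]

/-- `v` is a nonzero vector of weight `m ϖ₁ + n ϖ₂` for the diagonal torus of `SU(3)`. -/
def IsWeightVector (ρ : Representation ℂ SU3 H) (m n : ℤ) (v : H) : Prop :=
  v ≠ 0 ∧ ∀ g : SU3, (g : Mat3).IsDiag →
    ρ g v = ((g : Mat3) 0 0 ^ (m + n) * (g : Mat3) 1 1 ^ n) • v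

/-- `ρ` is a unitary irreducible representation of `SU(3)` with highest weight `ω_(p,q)`: this is
a weight of `ρ` and every weight of `ρ` is obtained from it by subtracting a sum of the simple
roots `2 ϖ₁ - ϖ₂` and `2 ϖ₂ - ϖ₁`. -/
structure IsQuarkSystem (p q : ℕ) (ρ : Representation ℂ SU3 H) : Prop where
  unitary : ∀ g v, ‖ρ g v‖ = ‖v‖
  continuous : ∀ v, Continuous fun g => ρ g v
  irreducible : ρ.IsIrreducible
  weight : ∃ v, IsWeightVector ρ p q v
  highest : ∀ m n : ℤ, (∃ v, IsWeightVector ρ m n v) →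
    ∃ k l : ℕ, m = p - 2 * k + l ∧ n = q + k - 2 * l

variable [FiniteDimensional ℂ H]

/-- The Hilbert–Schmidt inner product `tr (A† B)`. -/
def hsInner (A B : Module.End ℂ H) : ℂ := LinearMap.trace ℂ H (LinearMap.adjoint A * B)

/-- A symbol correspondence from the operators on `H` to the polynomials on the orbit: an
injective linear map that is equivariant, real and normalized. -/
structure IsSymbolCorrespondence {ξ : Mat3} (ρ : Representation ℂ SU3 H)
    (W : Module.End ℂ H →ₗ[ℂ] OrbitPoly ξ) : Prop where
  injective : Function.Injective W
  equivariant : ∀ (g : SU3) (A : Module.End ℂ H) (x : orbit ξ),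
    (W (ρ g * A * ρ g⁻¹) : orbit ξ → ℂ) (ad ξ g x) = (W A : orbit ξ → ℂ) x
  real : ∀ (A : Module.End ℂ H) (x : orbit ξ),
    (W (LinearMap.adjoint A) : orbit ξ → ℂ) x = (starRingEnd ℂ) ((W A : orbit ξ → ℂ) x)
  normalized : ∀ A : Module.End ℂ H,
    orbitIntegral (W A : orbit ξ → ℂ) = LinearMap.trace ℂ H A / (Module.finrank ℂ H : ℂ)

/-- The twisted product `W A ⋆ W B = W (A B)` on the image of `W` (with an unspecified value if
one of the factors is not in the image). -/
def twisted {ξ : Mat3} (W : Module.End ℂ H →ₗ[ℂ] OrbitPoly ξ) (f₁ f₂ : OrbitPoly ξ) : OrbitPoly ξ :=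
  W (Function.invFun W f₁ * Function.invFun W f₂)

end Representations

/-- A family of symbol correspondences is of Poisson type: `f₁ ⋆ˢ f₂ → f₁ f₂` and
`s r(ξ) [f₁, f₂]_⋆ˢ → i {f₁, f₂}` uniformly on the orbit, for all polynomials on the orbit. -/
structure IsPoissonType (ξ : Mat3) {H : ℕ → Type*} [∀ s, NormedAddCommGroup (H s)]
    [∀ s, InnerProductSpace ℂ (H s)] [∀ s, FiniteDimensional ℂ (H s)]
    (W : ∀ s, Module.End ℂ (H s) →ₗ[ℂ] OrbitPoly ξ) : Prop where
  product : ∀ f₁ f₂ : OrbitPoly ξ,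
    Tendsto (fun s => supNorm (twisted (W s) f₁ f₂ - f₁ * f₂)) atTop (𝓝 0)
  bracket : ∀ P₁ P₂ : MvPolynomial (Fin 8) ℂ,
    Tendsto (fun s : ℕ => supNorm
      (((s * intRadius ξ : ℝ) : ℂ) • (twisted (W s) (toPoly ξ P₁) (toPoly ξ P₂)
          - twisted (W s) (toPoly ξ P₂) (toPoly ξ P₁))
        - Complex.I • toPoly ξ (lieBracket P₁ P₂))) atTop (𝓝 0)

/-! ### Decompositions into irreducibles and characteristic matrices -/

section Decompositions

variable {K : Type*} [NormedAddCommGroup K] [InnerProductSpace ℂ K]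
  {H : Type*} [NormedAddCommGroup H] [InnerProductSpace ℂ H] {ξ : Mat3}

/-- `T` intertwines the representation `π` with the conjugation action on operators. -/
def IsOpIntertwiner (π : Representation ℂ SU3 K) (ρ : Representation ℂ SU3 H)
    (T : K →ₗ[ℂ] Module.End ℂ H) : Prop :=
  ∀ g k, T (π g k) = ρ g * T k * ρ g⁻¹

/-- `T` intertwines the representation `π` with the action on functions on the orbit. -/
def IsFunIntertwiner (π : Representation ℂ SU3 K) (T : K →ₗ[ℂ] OrbitPoly ξ) : Prop :=
  ∀ g k x, (T (π g k) : orbit ξ → ℂ) (ad ξ g x) = (T k : orbit ξ → ℂ) x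

/-- `e` is an orthogonal decomposition of the isotypic component of `π` in the space of operators
on `H` (with the Hilbert–Schmidt inner product) into copies of `π`: for an orthonormal basis
`k_ν` of `K`, the operators `e σ k_ν` form an orthonormal basis of this isotypic component, and
for each `σ` they transform as the `k_ν`. -/
structure IsOpDecomposition [FiniteDimensional ℂ H] (π : Representation ℂ SU3 K)
    (ρ : Representation ℂ SU3 H) {n : ℕ} (e : Fin n → K →ₗ[ℂ] Module.End ℂ H) : Prop where
  intertwines : ∀ σ, IsOpIntertwiner π ρ (e σ)
  orthonormal : ∀ σ τ k l, hsInner (e σ k) (e τ l) = if σ = τ then inner ℂ k l else 0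
  complete : ∀ T : K →ₗ[ℂ] Module.End ℂ H, IsOpIntertwiner π ρ T →
    T ∈ Submodule.span ℂ (Set.range e)

/-- `X` is an orthogonal decomposition of the isotypic component of `π` in the space of polynomial
functions on the orbit into copies of `π`; the functions `X γ k_ν` are the harmonic functions. -/
structure IsFunDecomposition (π : Representation ℂ SU3 K) {m : ℕ}
    (X : Fin m → K →ₗ[ℂ] OrbitPoly ξ) : Prop where
  intertwines : ∀ γ, IsFunIntertwiner π (X γ)
  orthonormal : ∀ γ δ k l, orbitInner (X γ k) (X δ l) = if γ = δ then inner ℂ k l else 0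
  complete : ∀ T : K →ₗ[ℂ] OrbitPoly ξ, IsFunIntertwiner π T → T ∈ Submodule.span ℂ (Set.range X)

/-- The characteristic matrix of `W` for the decompositions `e` and `X`, read off at a unit vector
`k` of the representation: its entries are the coefficients of the symbols of `√(dim H) (e σ k)`
in the orthonormal functions `X γ k`. -/
def charMatrix (W : Module.End ℂ H →ₗ[ℂ] OrbitPoly ξ) {n m : ℕ}
    (e : Fin n → K →ₗ[ℂ] Module.End ℂ H) (X : Fin m → K →ₗ[ℂ] OrbitPoly ξ) (k : K) :
    Matrix (Fin m) (Fin n) ℂ :=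
  Matrix.of fun γ σ =>
    orbitInner (X γ k) (W (((√(Module.finrank ℂ H : ℝ) : ℝ) : ℂ) • e σ k))

end Decompositions

end

end QuarkSystems

open QuarkSystems

/-! Write `C` for the characteristic matrix at level `s`. When the multiplicities agree, `C` is
invertible because `W` is injective, so each harmonic function `X γ k` is the symbol of an operator
`A γ`. Expanding `A γ` through `C⁻¹` gives `Cᴴ G C = 1`, where `G` is the Gram matrix of the `A γ`
divided by the dimension (`exists_symbol_preimages`). Since `W` is real and normalized, the entries
of `G` are integrals of twisted products of a conjugated harmonic function with a harmonic function.
These products converge uniformly to the pointwise ones, so `G` tends to the Gram matrix of the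
harmonic functions, which is the identity, and then `Cᴴ C` tends to the identity
(`norm_conjTranspose_mul_self_sub_one_le`).

It remains to compare multiplicities. Injectivity of `W` gives `n s ≤ m`
(`charMatrix_mulVec_injective`). For the converse, a family of functions is quantized by integrating
it against the projections onto the translates of a highest weight vector `v` (`coherentMap`). The
expectation of the result in `v` is the average of the function with density proportional to `|⟨v, ρ
g v⟩|²`. This density is a multiple of the `s`-th power of one fixed function on the group
(`inner_highestWeight`), and that function reaches its maximum only on the stabilizer of `ξ`, so the
averages tend to the value at the base point (`tendsto_integral_pow`). An equivariant family is
determined by its values there, and linear independence is an open condition, so for large `s` the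
quantized `X γ` are independent and `m ≤ n s`.

The formula for the highest weight coefficient needs a complexification of the group. The Zariski
closure of `SU(3)` in the space of matrices plays this role: matrix coefficients are polynomial
(`exists_polyFun_coefficient`), the representation extends multiplicatively to the closure, the
closure contains the diagonal matrices of determinant one and the upper unipotent ones, and the
Gauss decomposition reduces the coefficient to the diagonal factor. -/

namespace QuarkSystems

noncomputable section

/-! ### Polynomial functions on matrices and the Zariski closure of `SU(3)` -/

/-- The algebra of polynomial functions of the entries of a `3 × 3` matrix. -/
def polyFun : Subalgebra ℂ (Mat3 → ℂ) :=
  Algebra.adjoin ℂ (Set.range fun ij : Fin 3 × Fin 3 => fun A : Mat3 => A ij.1 ij.2)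

theorem entry_mem_polyFun (i j : Fin 3) : (fun A : Mat3 => A i j) ∈ polyFun :=
  Algebra.subset_adjoin ⟨(i, j), rfl⟩

theorem polyFun_induction {p : (F : Mat3 → ℂ) → F ∈ polyFun → Prop}
    (entry : ∀ i j, p (fun A => A i j) (entry_mem_polyFun i j))
    (const : ∀ c : ℂ, p (fun _ => c) (polyFun.algebraMap_mem c))
    (add : ∀ F G hF hG, p F hF → p G hG → p (fun A => F A + G A) (polyFun.add_mem hF hG))
    (mul : ∀ F G hF hG, p F hF → p G hG → p (fun A => F A * G A) (polyFun.mul_mem hF hG))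
    {F : Mat3 → ℂ} (hF : F ∈ polyFun) : p F hF := by
  induction hF using Algebra.adjoin_induction with
  | mem x hx => obtain ⟨ij, rfl⟩ := hx; exact entry _ _
  | algebraMap r => exact const r
  | add x y hx' hy' hx hy => exact add x y hx' hy' hx hy
  | mul x y hx' hy' hx hy => exact mul x y hx' hy' hx hy

theorem const_mem_polyFun (c : ℂ) : (fun _ : Mat3 => c) ∈ polyFun := polyFun.algebraMap_mem c

theorem add_mem_polyFun {F G : Mat3 → ℂ} (hF : F ∈ polyFun) (hG : G ∈ polyFun) :
    (fun A => F A + G A) ∈ polyFun := polyFun.add_mem hF hG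

theorem sub_mem_polyFun {F G : Mat3 → ℂ} (hF : F ∈ polyFun) (hG : G ∈ polyFun) :
    (fun A => F A - G A) ∈ polyFun := polyFun.sub_mem hF hG

theorem mul_mem_polyFun {F G : Mat3 → ℂ} (hF : F ∈ polyFun) (hG : G ∈ polyFun) :
    (fun A => F A * G A) ∈ polyFun := polyFun.mul_mem hF hG

theorem pow_mem_polyFun {F : Mat3 → ℂ} (hF : F ∈ polyFun) (n : ℕ) :
    (fun A => F A ^ n) ∈ polyFun := polyFun.pow_mem hF n

theorem sum_mem_polyFun {ι : Type*} {s : Finset ι} {F : ι → Mat3 → ℂ}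
    (hF : ∀ i ∈ s, F i ∈ polyFun) : (fun A => ∑ i ∈ s, F i A) ∈ polyFun := by
  convert polyFun.sum_mem hF using 1
  ext A
  simp

theorem continuous_of_mem_polyFun {F : Mat3 → ℂ} (hF : F ∈ polyFun) : Continuous F := by
  induction hF using polyFun_induction with
  | entry i j => exact continuous_id.matrix_elem i j
  | const c => exact continuous_const
  | add F G _ _ hF hG => exact hF.add hG
  | mul F G _ _ hF hG => exact hF.mul hG

theorem differentiable_comp_of_mem_polyFun {F : Mat3 → ℂ} (hF : F ∈ polyFun) {c : ℂ → Mat3}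
    (hc : ∀ i j, Differentiable ℂ fun z => c z i j) : Differentiable ℂ fun z => F (c z) := by
  induction hF using polyFun_induction with
  | entry i j => exact hc i j
  | const c => exact differentiable_const _
  | add F G _ _ hF hG => exact hF.add hG
  | mul F G _ _ hF hG => exact hF.mul hG

/-- Substituting matrix entries that are polynomial functions. -/
theorem comp_mem_polyFun {F : Mat3 → ℂ} (hF : F ∈ polyFun) {c : Mat3 → Mat3}
    (hc : ∀ i j, (fun A => c A i j) ∈ polyFun) : (fun A => F (c A)) ∈ polyFun := by
  induction hF using polyFun_induction with
  | entry i j => exact hc i j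
  | const c => exact const_mem_polyFun _
  | add F G _ _ hF hG => exact add_mem_polyFun hF hG
  | mul F G _ _ hF hG => exact mul_mem_polyFun hF hG

theorem mul_left_mem_polyFun {F : Mat3 → ℂ} (hF : F ∈ polyFun) (B : Mat3) :
    (fun A => F (B * A)) ∈ polyFun :=
  comp_mem_polyFun hF fun i j => by
    simp only [Matrix.mul_apply]
    exact sum_mem_polyFun fun k _ => mul_mem_polyFun (const_mem_polyFun _) (entry_mem_polyFun _ _)

theorem mul_right_mem_polyFun {F : Mat3 → ℂ} (hF : F ∈ polyFun) (B : Mat3) :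
    (fun A => F (A * B)) ∈ polyFun :=
  comp_mem_polyFun hF fun i j => by
    simp only [Matrix.mul_apply]
    exact sum_mem_polyFun fun k _ => mul_mem_polyFun (entry_mem_polyFun _ _) (const_mem_polyFun _)

/-- The conjugations in the argument and in the value cancel, so the dependence on the entries stays
holomorphic. -/
theorem conj_conjTranspose_mem_polyFun {F : Mat3 → ℂ} (hF : F ∈ polyFun) :
    (fun A => starRingEnd ℂ (F Aᴴ)) ∈ polyFun := by
  induction hF using polyFun_induction with
  | entry i j => simpa using entry_mem_polyFun j i
  | const c => exact const_mem_polyFun _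
  | add F G _ _ hF hG => simpa using add_mem_polyFun hF hG
  | mul F G _ _ hF hG => simpa using mul_mem_polyFun hF hG

theorem adjugate_mem_polyFun (i j : Fin 3) : (fun A : Mat3 => A.adjugate i j) ∈ polyFun := by
  have h := entry_mem_polyFun
  simp only [Matrix.adjugate_fin_three]
  fin_cases i <;> fin_cases j <;> simp <;>
    first
    | exact sub_mem_polyFun (mul_mem_polyFun (h _ _) (h _ _)) (mul_mem_polyFun (h _ _) (h _ _))
    | (simp only [neg_add_eq_sub]
       exact sub_mem_polyFun (mul_mem_polyFun (h _ _) (h _ _)) (mul_mem_polyFun (h _ _) (h _ _)))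

theorem SU3.conjTranspose_mul (g : SU3) : (g : Mat3)ᴴ * g = 1 := g.2.1.1

theorem SU3.mul_conjTranspose (g : SU3) : (g : Mat3) * (g : Mat3)ᴴ = 1 := g.2.1.2

theorem SU3.det_eq_one (g : SU3) : (g : Mat3).det = 1 := g.2.2

theorem SU3.coe_inv (g : SU3) : ((g⁻¹ : SU3) : Mat3) = (g : Mat3)ᴴ := rfl

theorem SU3.adjugate (g : SU3) : (g : Mat3).adjugate = (g : Mat3)ᴴ := by
  have h := Matrix.mul_adjugate (g : Mat3)
  rw [SU3.det_eq_one, one_smul] at h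
  calc (g : Mat3).adjugate = (g : Mat3)ᴴ * g * (g : Mat3).adjugate := by
        rw [SU3.conjTranspose_mul, one_mul]
    _ = _ := by rw [mul_assoc, h, mul_one]

/-- On `SU(3)` the complex conjugate of a polynomial function is a polynomial function. -/
theorem exists_conj_polyFun {F : Mat3 → ℂ} (hF : F ∈ polyFun) :
    ∃ G ∈ polyFun, ∀ g : SU3, G g = starRingEnd ℂ (F g) := by
  -- On `SU(3)` the adjugate is the inverse, hence the conjugate transpose, so `A.adjugateᴴ` is `A`
  -- there while the whole expression remains polynomial.
  refine ⟨fun A => starRingEnd ℂ (F A.adjugateᴴ),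
    comp_mem_polyFun (conj_conjTranspose_mem_polyFun hF) adjugate_mem_polyFun, fun g => ?_⟩
  simp only [SU3.adjugate, Matrix.conjTranspose_conjTranspose]

/-- Polynomial functions of a product are sums of products of polynomial functions. -/
theorem exists_sum_of_mem_polyFun {F : Mat3 → ℂ} (hF : F ∈ polyFun) :
    ∃ (n : ℕ) (p q : Fin n → Mat3 → ℂ), (∀ i, p i ∈ polyFun) ∧ (∀ i, q i ∈ polyFun) ∧
      ∀ A B, F (A * B) = ∑ i, p i A * q i B := by
  suffices h : ∃ (ι : Type) (_ : Fintype ι) (p q : ι → Mat3 → ℂ), (∀ i, p i ∈ polyFun) ∧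
      (∀ i, q i ∈ polyFun) ∧ ∀ A B, F (A * B) = ∑ i, p i A * q i B by
    obtain ⟨ι, _, p, q, hp, hq, h⟩ := h
    let e := Fintype.equivFin ι
    refine ⟨_, p ∘ e.symm, q ∘ e.symm, fun i => hp _, fun i => hq _, fun A B => ?_⟩
    rw [h]
    exact (Equiv.sum_comp e.symm fun i => p i A * q i B).symm
  induction hF using polyFun_induction with
  | entry i j =>
    exact ⟨Fin 3, inferInstance, fun k A => A i k, fun k A => A k j,
      fun k => entry_mem_polyFun _ _, fun k => entry_mem_polyFun _ _, fun A B => rfl⟩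
  | const c =>
    exact ⟨Unit, inferInstance, fun _ _ => c, fun _ _ => 1, fun _ => const_mem_polyFun _,
      fun _ => const_mem_polyFun _, fun A B => by simp⟩
  | add F G _ _ hF hG =>
    obtain ⟨ι, _, p, q, hp, hq, h⟩ := hF
    obtain ⟨κ, _, p', q', hp', hq', h'⟩ := hG
    refine ⟨ι ⊕ κ, inferInstance, Sum.elim p p', Sum.elim q q', ?_, ?_, fun A B => ?_⟩
    · rintro (i | i); exacts [hp i, hp' i]
    · rintro (i | i); exacts [hq i, hq' i]
    · simp [h, h']
  | mul F G _ _ hF hG =>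
    obtain ⟨ι, _, p, q, hp, hq, h⟩ := hF
    obtain ⟨κ, _, p', q', hp', hq', h'⟩ := hG
    refine ⟨ι × κ, inferInstance, fun i A => p i.1 A * p' i.2 A, fun i A => q i.1 A * q' i.2 A,
      fun i => mul_mem_polyFun (hp _) (hp' _), fun i => mul_mem_polyFun (hq _) (hq' _),
      fun A B => ?_⟩
    simp only [h, h', Finset.sum_mul_sum, Fintype.sum_prod_type]
    exact Finset.sum_congr rfl fun i _ => Finset.sum_congr rfl fun j _ => by ring

/-- The Zariski closure of `SU(3)` in the space of matrices. -/
def zariskiSU3 : Set Mat3 := {A | ∀ F ∈ polyFun, (∀ g : SU3, F g = 0) → F A = 0}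

theorem coe_mem_zariskiSU3 (g : SU3) : (g : Mat3) ∈ zariskiSU3 := fun _ _ h => h g

/-- One factor at a time: vanishing on `SU(3)` passes to the products `A * g` for each fixed `g`,
and then from `g` to `B`. -/
theorem mul_mem_zariskiSU3 {A B : Mat3} (hA : A ∈ zariskiSU3) (hB : B ∈ zariskiSU3) :
    A * B ∈ zariskiSU3 := fun F hF h => by
  refine hB (fun B => F (A * B)) (mul_left_mem_polyFun hF A) fun g => ?_
  refine hA (fun A => F (A * g)) (mul_right_mem_polyFun hF g) fun g' => ?_
  exact h (g' * g)

theorem conjTranspose_mem_zariskiSU3 {A : Mat3} (hA : A ∈ zariskiSU3) : Aᴴ ∈ zariskiSU3 :=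
  fun F hF h => by
    have := hA _ (conj_conjTranspose_mem_polyFun hF) fun g => by
      rw [← SU3.coe_inv, h, map_zero]
    simpa using this

theorem isClosed_zariskiSU3 : IsClosed zariskiSU3 := by
  have : zariskiSU3 = ⋂ F ∈ {F | F ∈ polyFun ∧ ∀ g : SU3, F g = 0}, {A | F A = 0} := by
    ext A
    simp [zariskiSU3]
  rw [this]
  exact isClosed_biInter fun F hF =>
    isClosed_eq (continuous_of_mem_polyFun hF.1) continuous_const

theorem det_eq_one_of_mem_zariskiSU3 {A : Mat3} (hA : A ∈ zariskiSU3) : A.det = 1 := by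
  have h := entry_mem_polyFun
  have hdet : (fun A : Mat3 => A.det) ∈ polyFun := by
    simp only [Matrix.det_succ_row_zero (n := 2), Fin.sum_univ_three, Matrix.det_fin_two]
    refine add_mem_polyFun (add_mem_polyFun ?_ ?_) ?_ <;>
    exact mul_mem_polyFun (mul_mem_polyFun (const_mem_polyFun _) (h _ _)) (sub_mem_polyFun
      (mul_mem_polyFun (h _ _) (h _ _)) (mul_mem_polyFun (h _ _) (h _ _)))
  have := hA _ (sub_mem_polyFun hdet (const_mem_polyFun 1)) fun g => by
    rw [SU3.det_eq_one, sub_self]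
  linear_combination this

/-! ### The complexified torus -/

/-- An entire function that vanishes on the imaginary axis is zero. -/
theorem eq_zero_of_imaginary_axis {h : ℂ → ℂ} (hh : Differentiable ℂ h)
    (h0 : ∀ t : ℝ, h (t * Complex.I) = 0) (z : ℂ) : h z = 0 := by
  have han : AnalyticOnNhd ℂ h Set.univ := fun z _ => hh.analyticAt z
  have hfr : ∃ᶠ z in 𝓝[≠] (0 : ℂ), h z = 0 := by
    have ht : Tendsto (fun t : ℝ => (t : ℂ) * Complex.I) (𝓝[≠] 0) (𝓝[≠] 0) := by
      refine tendsto_nhdsWithin_iff.2 ⟨?_, ?_⟩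
      · have : Continuous fun t : ℝ => (t : ℂ) * Complex.I := by fun_prop
        simpa using (this.tendsto 0).mono_left nhdsWithin_le_nhds
      · filter_upwards [self_mem_nhdsWithin] with t ht
        simpa using ht
    exact ht.frequently (Eventually.frequently (Eventually.of_forall h0))
  exact han.eqOn_zero_of_preconnected_of_frequently_eq_zero isPreconnected_univ
    (Set.mem_univ 0) hfr (Set.mem_univ z)

/-- The diagonal matrices of determinant one, in logarithmic coordinates. -/
def expDiag (z w : ℂ) : Mat3 :=
  Matrix.diagonal ![Complex.exp z, Complex.exp w, Complex.exp (-z - w)]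

theorem expDiag_imaginary_mem (t u : ℝ) :
    expDiag (t * Complex.I) (u * Complex.I) ∈ Matrix.specialUnitaryGroup (Fin 3) ℂ := by
  have key : ∀ a : ℂ, starRingEnd ℂ a = -a → starRingEnd ℂ (Complex.exp a) * Complex.exp a = 1 := by
    intro a ha
    rw [← Complex.exp_conj, ha, ← Complex.exp_add, neg_add_cancel, Complex.exp_zero]
  rw [Matrix.mem_specialUnitaryGroup_iff]
  refine ⟨Matrix.mem_unitaryGroup_iff'.2 ?_, ?_⟩
  · rw [expDiag, Matrix.star_eq_conjTranspose, Matrix.diagonal_conjTranspose,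
      Matrix.diagonal_mul_diagonal, ← Matrix.diagonal_one]
    congr 1
    ext i
    fin_cases i <;> simp only [Pi.star_apply] <;> apply key <;> simp <;> ring
  · rw [expDiag, Matrix.det_diagonal]
    simp [Fin.prod_univ_three, ← Complex.exp_add]

/-- A polynomial function that vanishes on the torus vanishes on its complexification. -/
theorem eq_zero_expDiag {F : Mat3 → ℂ} (hF : F ∈ polyFun)
    (h : ∀ g : SU3, (g : Mat3).IsDiag → F g = 0) (z w : ℂ) : F (expDiag z w) = 0 := by
  have hd : ∀ t u : ℝ, F (expDiag (t * Complex.I) (u * Complex.I)) = 0 := fun t u =>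
    h ⟨_, expDiag_imaginary_mem t u⟩ (Matrix.isDiag_diagonal _)
  -- The two logarithmic coordinates leave the imaginary axis one after the other.
  have h1 : ∀ (t : ℝ) (w : ℂ), F (expDiag (t * Complex.I) w) = 0 := fun t =>
    eq_zero_of_imaginary_axis (differentiable_comp_of_mem_polyFun hF fun i j => by
      fin_cases i <;> fin_cases j <;> simp [expDiag] <;> fun_prop) (hd t)
  exact eq_zero_of_imaginary_axis (h := fun z => F (expDiag z w))
    (differentiable_comp_of_mem_polyFun hF fun i j => by
      fin_cases i <;> fin_cases j <;> simp [expDiag] <;> fun_prop) (fun t => h1 t w) z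

theorem expDiag_mem_zariskiSU3 (z w : ℂ) : expDiag z w ∈ zariskiSU3 :=
  fun _ hF h => eq_zero_expDiag hF (fun g _ => h g) z w

theorem exists_expDiag {a b c : ℂ} (h : a * b * c = 1) :
    ∃ z w, expDiag z w = Matrix.diagonal ![a, b, c] := by
  have ha : a ≠ 0 := by rintro rfl; simp at h
  have hb : b ≠ 0 := by rintro rfl; simp at h
  refine ⟨Complex.log a, Complex.log b, ?_⟩
  rw [expDiag, sub_eq_add_neg, Complex.exp_add, Complex.exp_neg, Complex.exp_neg,
    Complex.exp_log ha, Complex.exp_log hb]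
  congr
  field_simp
  linear_combination -h

theorem diagonal_mem_zariskiSU3 {a b c : ℂ} (h : a * b * c = 1) :
    Matrix.diagonal ![a, b, c] ∈ zariskiSU3 := by
  obtain ⟨z, w, hzw⟩ := exists_expDiag h
  exact hzw ▸ expDiag_mem_zariskiSU3 z w

/-! ### Unipotent matrices in the Zariski closure -/

/-- A rotation in a coordinate plane, conjugated by a diagonal matrix. -/
def planeRotation (i j : Fin 3) (c s s' : ℂ) : Mat3 :=
  Matrix.of fun k l => if k = i then (if l = i then c else if l = j then s else 0)
    else if k = j then (if l = i then -s' else if l = j then c else 0)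
    else if k = l then 1 else 0

theorem planeRotation_mem {i j : Fin 3} (hij : i < j) (θ : ℝ) :
    planeRotation i j (Real.cos θ : ℝ) (Real.sin θ : ℝ) (Real.sin θ : ℝ) ∈
      Matrix.specialUnitaryGroup (Fin 3) ℂ := by
  have h : ((Real.cos θ : ℝ) : ℂ) * (Real.cos θ : ℝ) + (Real.sin θ : ℝ) * (Real.sin θ : ℝ) = 1 := by
    norm_cast
    nlinarith [Real.sin_sq_add_cos_sq θ]
  set c := Real.cos θ
  set s := Real.sin θ
  rw [Matrix.mem_specialUnitaryGroup_iff]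
  refine ⟨Matrix.mem_unitaryGroup_iff'.2 ?_, ?_⟩
  · ext k l
    fin_cases i <;> fin_cases j <;> simp at hij <;> fin_cases k <;> fin_cases l <;>
      simp [Matrix.mul_apply, Fin.sum_univ_three, planeRotation] <;>
      first | linear_combination h | ring
  · fin_cases i <;> fin_cases j <;> simp at hij <;>
      simp [Matrix.det_fin_three, planeRotation] <;> linear_combination h

theorem transvection_eq_planeRotation {i j : Fin 3} (hij : i < j) (z : ℂ) :
    Matrix.transvection i j z = planeRotation i j 1 z 0 := by
  ext k l
  fin_cases i <;> fin_cases j <;> simp at hij <;> fin_cases k <;> fin_cases l <;>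
    simp [Matrix.transvection, planeRotation]

/-- Conjugating a rotation by the diagonal matrix with entries `d`, `d⁻¹` in the plane multiplies
one off-diagonal entry by `d²` and the other by `d⁻²`. The choice `d² = z / sin θ` makes the first
one equal to `z`. -/
theorem planeRotation_mem_zariskiSU3 {i j : Fin 3} (hij : i < j) {z : ℂ} (hz : z ≠ 0) {θ : ℝ}
    (hθ : Real.sin θ ≠ 0) :
    planeRotation i j (Real.cos θ : ℝ) z ((Real.sin θ : ℝ) ^ 2 / z) ∈ zariskiSU3 := by
  have hs : ((Real.sin θ : ℝ) : ℂ) ≠ 0 := by exact_mod_cast hθ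
  have hR : planeRotation i j (Real.cos θ : ℝ) (Real.sin θ : ℝ) (Real.sin θ : ℝ) ∈ zariskiSU3 :=
    coe_mem_zariskiSU3 ⟨_, planeRotation_mem hij θ⟩
  clear hθ
  generalize ((Real.cos θ : ℝ) : ℂ) = c at *
  generalize ((Real.sin θ : ℝ) : ℂ) = s at *
  obtain ⟨d, hd⟩ : ∃ d : ℂ, d ^ 2 = z / s := ⟨_, Complex.cpow_ofNat_inv_pow (z / s) 2⟩
  have hd0 : d ≠ 0 := by
    rintro rfl
    have : z / s ≠ 0 := div_ne_zero hz hs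
    exact this (by rw [← hd]; simp)
  have hz' : z = d ^ 2 * s := by rw [hd]; field_simp
  have hdiag : ∀ f : Fin 3 → ℂ, f = ![f 0, f 1, f 2] := fun f => by
    ext k; fin_cases k <;> rfl
  have hD : ∀ x : ℂ, x ≠ 0 →
      Matrix.diagonal (Function.update (Function.update 1 i x) j x⁻¹) ∈ zariskiSU3 := by
    intro x hx
    rw [hdiag (Function.update _ _ _)]
    refine diagonal_mem_zariskiSU3 ?_
    fin_cases i <;> fin_cases j <;> simp at hij <;> simp [hx]
  have h := mul_mem_zariskiSU3 (mul_mem_zariskiSU3 (hD d hd0) hR) (hD d⁻¹ (inv_ne_zero hd0))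
  convert h using 1
  subst hz'
  ext k l
  rw [Matrix.mul_diagonal, Matrix.diagonal_mul]
  fin_cases i <;> fin_cases j <;> simp at hij <;> fin_cases k <;> fin_cases l <;>
    simp [planeRotation] <;> field_simp

/-- As `θ → 0` with `z` fixed, the rescaled rotations lose their lower off-diagonal entry and
converge to the transvection, and the Zariski closure is closed. -/
theorem transvection_mem_zariskiSU3 {i j : Fin 3} (hij : i < j) (z : ℂ) :
    Matrix.transvection i j z ∈ zariskiSU3 := by
  by_cases hz : z = 0
  · rw [hz, Matrix.transvection_zero]
    exact coe_mem_zariskiSU3 1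
  let c : ℝ → Mat3 := fun θ =>
    planeRotation i j (Real.cos θ : ℝ) z ((Real.sin θ : ℝ) ^ 2 / z)
  have hc : Continuous c := by
    refine continuous_matrix fun k l => ?_
    simp only [c, planeRotation, Matrix.of_apply]
    split_ifs <;> fun_prop
  have h0 : c 0 = Matrix.transvection i j z := by
    simp [c, transvection_eq_planeRotation hij]
  rw [← h0]
  refine isClosed_zariskiSU3.mem_of_tendsto
    ((hc.tendsto 0).mono_left (nhdsWithin_le_nhds (s := Set.Ioi 0))) ?_
  filter_upwards [Ioo_mem_nhdsGT Real.pi_pos] with θ hθ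
  exact planeRotation_mem_zariskiSU3 hij hz (Real.sin_pos_of_pos_of_lt_pi hθ.1 hθ.2).ne'

/-- The leading principal minor of size two. -/
def minor₂ (A : Mat3) : ℂ := A 0 0 * A 1 1 - A 0 1 * A 1 0

theorem minor₂_mem_polyFun : minor₂ ∈ polyFun :=
  sub_mem_polyFun (mul_mem_polyFun (entry_mem_polyFun _ _) (entry_mem_polyFun _ _))
    (mul_mem_polyFun (entry_mem_polyFun _ _) (entry_mem_polyFun _ _))

/-- An upper triangular unipotent matrix. -/
def unipotent (x y z : ℂ) : Mat3 := Matrix.transvection 0 1 x * Matrix.transvection 0 2 y *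
  Matrix.transvection 1 2 z

theorem unipotent_mem_zariskiSU3 (x y z : ℂ) : unipotent x y z ∈ zariskiSU3 :=
  mul_mem_zariskiSU3 (mul_mem_zariskiSU3 (transvection_mem_zariskiSU3 (by decide) x)
    (transvection_mem_zariskiSU3 (by decide) y)) (transvection_mem_zariskiSU3 (by decide) z)

theorem unipotent_eq (x y z : ℂ) : unipotent x y z = !![1, x, y + x * z; 0, 1, z; 0, 0, 1] := by
  ext k l
  fin_cases k <;> fin_cases l <;>
    simp [unipotent, Matrix.transvection, Matrix.mul_apply, Fin.sum_univ_three,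
      Matrix.single_apply, Matrix.one_apply, add_comm]

/-- The Gauss decomposition of a matrix of determinant one with nonvanishing leading principal
minors. -/
theorem exists_gauss_decomposition {A : Mat3} (hA : A.det = 1) (h₁ : A 0 0 ≠ 0)
    (h₂ : minor₂ A ≠ 0) : ∃ x y z x' y' z' : ℂ, A = (unipotent x y z)ᴴ *
      Matrix.diagonal ![A 0 0, minor₂ A / A 0 0, 1 / minor₂ A] * unipotent x' y' z' := by
  have key : ∃ x y z x' y' z' : ℂ, A = !![1, 0, 0; x, 1, 0; y, z, 1] *
      Matrix.diagonal ![A 0 0, minor₂ A / A 0 0, 1 / minor₂ A] *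
        !![1, x', y'; 0, 1, z'; 0, 0, 1] := by
    -- The classical quotients of minors in the triangular factors.
    refine ⟨A 1 0 / A 0 0, A 2 0 / A 0 0, (A 0 0 * A 2 1 - A 2 0 * A 0 1) / minor₂ A,
      A 0 1 / A 0 0, A 0 2 / A 0 0, (A 0 0 * A 1 2 - A 1 0 * A 0 2) / minor₂ A, ?_⟩
    rw [Matrix.det_fin_three] at hA
    ext k l
    rw [Matrix.mul_apply, Fin.sum_univ_three]
    simp only [Matrix.mul_diagonal]
    fin_cases k <;> fin_cases l <;> simp <;> field_simp
    · simp only [minor₂]; ring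
    · ring
    · ring
    · simp only [minor₂] at h₂ ⊢
      linear_combination (A 0 0) * hA
  obtain ⟨x, y, z, x', y', z', h⟩ := key
  -- The corner entry of `unipotent x y z` is `y + x * z`, which accounts for the subtracted
  -- products.
  refine ⟨star x, star (y - x * z), star z, x', y' - x' * z', z', h.trans ?_⟩
  rw [unipotent_eq, unipotent_eq]
  congr 2
  · ext k l
    fin_cases k <;> fin_cases l <;> simp
  · ext k l
    fin_cases k <;> fin_cases l <;> simp

/-- A continuous function on matrices that vanishes at the points of the Zariski closure with
nonvanishing leading principal minors vanishes on the whole Zariski closure. -/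
theorem eq_zero_of_generic {h : Mat3 → ℂ} (hc : Continuous h)
    (h0 : ∀ A ∈ zariskiSU3, A 0 0 ≠ 0 → minor₂ A ≠ 0 → h A = 0) {A : Mat3}
    (hA : A ∈ zariskiSU3) : h A = 0 := by
  have path : ∀ (A : Mat3) (i j : Fin 3),
      (∀ z ≠ 0, h (Matrix.transvection i j z * A) = 0) → h A = 0 := by
    intro A i j hh
    have hcont : Continuous fun z : ℂ => h (Matrix.transvection i j z * A) := by
      refine hc.comp (Continuous.matrix_mul (continuous_matrix fun k l => ?_) continuous_const)
      simp only [Matrix.transvection, Matrix.add_apply, Matrix.single_apply]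
      split_ifs <;> fun_prop
    have ht : Tendsto (fun z : ℂ => h (Matrix.transvection i j z * A)) (𝓝[≠] 0) (𝓝 (h A)) := by
      simpa using (hcont.tendsto 0).mono_left nhdsWithin_le_nhds
    refine tendsto_nhds_unique ht (tendsto_const_nhds.congr' ?_)
    filter_upwards [self_mem_nhdsWithin] with z hz
    exact (hh z hz).symm
  have first : ∀ A ∈ zariskiSU3, A 0 0 ≠ 0 → h A = 0 := by
    intro A hA h₁
    by_cases h₂ : minor₂ A = 0
    -- Adding `z` times the last row to the middle one changes the vanishing minor by `z` times the
    -- minor of rows 0, 2 and columns 0, 1. If this were also zero, Sylvester's identity would give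
    -- `A 0 0 * det A = 0`.
    · refine path A 1 2 fun z hz => h0 _
        (mul_mem_zariskiSU3 (transvection_mem_zariskiSU3 (by decide) z) hA) ?_ ?_
      · simpa [Matrix.transvection, Matrix.add_mul, Matrix.single_mul_apply_of_ne] using h₁
      · have hdet := det_eq_one_of_mem_zariskiSU3 hA
        rw [Matrix.det_fin_three] at hdet
        intro h₃
        have h₄ : A 0 0 * A 2 1 - A 0 1 * A 2 0 = 0 := by
          refine (mul_eq_zero.1 (?_ : z * _ = 0)).resolve_left hz
          simp [minor₂, Matrix.transvection, Matrix.add_mul, Matrix.single_mul_apply_of_ne] at h₃ h₂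
          linear_combination h₃ - h₂
        have : A 0 0 * (1 : ℂ) = 0 := by
          simp only [minor₂] at h₂
          linear_combination (-A 0 0) * hdet + (A 0 0 * A 2 2 - A 0 2 * A 2 0) * h₂ -
            (A 0 0 * A 1 2 - A 0 2 * A 1 0) * h₄
        exact h₁ (by simpa using this)
    · exact h0 A hA h₁ h₂
  by_cases h₁ : A 0 0 = 0
  · obtain ⟨j, hj, hAj⟩ : ∃ j : Fin 3, 0 < j ∧ A j 0 ≠ 0 := by
      by_contra! hcon
      have hdet := det_eq_one_of_mem_zariskiSU3 hA
      rw [Matrix.det_fin_three, h₁, hcon 1 (by decide), hcon 2 (by decide)] at hdet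
      simp at hdet
    refine path A 0 j fun z hz => first _
        (mul_mem_zariskiSU3 (transvection_mem_zariskiSU3 hj z) hA) ?_
    simpa [Matrix.transvection, Matrix.add_mul, h₁] using ⟨hz, hAj⟩
  · exact first A hA h₁

/-! ### Haar measure and matrix coefficients -/

instance instIsHaarMeasureHaarSU3 : haarSU3.IsHaarMeasure := by
  unfold haarSU3; infer_instance

instance instIsProbabilityMeasureHaarSU3 : IsProbabilityMeasure haarSU3 :=
  ⟨by simpa [haarSU3] using Measure.haarMeasure_self (K₀ := (⊤ : TopologicalSpace.PositiveCompacts SU3))⟩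

theorem integrable_haarSU3 {V : Type*} [NormedAddCommGroup V] {f : SU3 → V} (hf : Continuous f) :
    Integrable f haarSU3 :=
  hf.integrable_of_hasCompactSupport (HasCompactSupport.of_compactSpace f)

section Coefficients

variable {H : Type*} [NormedAddCommGroup H] [InnerProductSpace ℂ H] {ρ : Representation ℂ SU3 H}

theorem inner_rep_rep (hu : ∀ g v, ‖ρ g v‖ = ‖v‖) (g : SU3) (u w : H) :
    inner ℂ (ρ g u) (ρ g w) = inner ℂ u w :=
  (⟨ρ g, hu g⟩ : H →ₗᵢ[ℂ] H).inner_map_map u w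

theorem rep_rep_inv (g : SU3) (w : H) : ρ g (ρ g⁻¹ w) = w := by
  rw [← Module.End.mul_apply, ← map_mul]; simp

theorem inner_rep_left (hu : ∀ g v, ‖ρ g v‖ = ‖v‖) (g : SU3) (u w : H) :
    inner ℂ (ρ g u) w = inner ℂ u (ρ g⁻¹ w) := by
  rw [← inner_rep_rep hu g u, rep_rep_inv]

theorem eq_top_of_invariant (hirr : ρ.IsIrreducible) (V : Submodule ℂ H)
    (hV : ∀ g, ∀ v ∈ V, ρ g v ∈ V) {v : H} (hv : v ∈ V) (h0 : v ≠ 0) : V = ⊤ := by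
  let V' : Subrepresentation ρ := ⟨V, fun g v hv => hV g v hv⟩
  rcases hirr.eq_bot_or_eq_top V' with h | h
  · have hv' : v ∈ V'.toSubmodule := hv
    rw [h] at hv'
    exact absurd ((Submodule.mem_bot ℂ).1 hv') h0
  · exact congrArg Subrepresentation.toSubmodule h

/-- The restrictions of polynomial functions to `SU(3)`. -/
def polySU3 : StarSubalgebra ℂ C(SU3, ℂ) where
  carrier := {f | ∃ F ∈ polyFun, ∀ g : SU3, F g = f g}
  mul_mem' := by
    rintro f f' ⟨F, hF, h⟩ ⟨F', hF', h'⟩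
    exact ⟨_, mul_mem_polyFun hF hF', fun g => by simp [h, h']⟩
  add_mem' := by
    rintro f f' ⟨F, hF, h⟩ ⟨F', hF', h'⟩
    exact ⟨_, add_mem_polyFun hF hF', fun g => by simp [h, h']⟩
  algebraMap_mem' c := ⟨_, const_mem_polyFun c, fun g => by simp [Algebra.algebraMap_eq_smul_one]⟩
  star_mem' := by
    rintro f ⟨F, hF, h⟩
    obtain ⟨G, hG, hGF⟩ := exists_conj_polyFun hF
    exact ⟨G, hG, fun g => by simp [hGF, h]⟩

/-- Stone–Weierstrass: the matrix entries separate points. -/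
theorem dense_polySU3 : Dense (polySU3 : Set C(SU3, ℂ)) := by
  have h := ContinuousMap.starSubalgebra_topologicalClosure_eq_top_of_separatesPoints polySU3 (by
    intro g g' hgg'
    obtain ⟨i, j, hij⟩ : ∃ i j, (g : Mat3) i j ≠ (g' : Mat3) i j := by
      by_contra! hcon
      exact hgg' (Subtype.ext (Matrix.ext hcon))
    refine ⟨fun g => (g : Mat3) i j, ⟨⟨fun g => (g : Mat3) i j,
      continuous_subtype_val.matrix_elem i j⟩, ?_, rfl⟩, hij⟩
    exact ⟨_, entry_mem_polyFun i j, fun g => rfl⟩)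
  rw [dense_iff_closure_eq, ← StarSubalgebra.topologicalClosure_coe, h]
  rfl

/-- A continuous function that is orthogonal to the polynomial functions is orthogonal to all
continuous functions. -/
theorem integral_mul_eq_zero_of_polyFun {c : SU3 → ℂ} (hc : Continuous c)
    (h : ∀ F ∈ polyFun, ∫ g : SU3, F g * c g ∂haarSU3 = 0) (f : C(SU3, ℂ)) :
    ∫ g : SU3, f g * c g ∂haarSU3 = 0 := by
  have hInt : ∀ f : C(SU3, ℂ), Integrable (fun g => f g * c g) haarSU3 := fun f =>
    integrable_haarSU3 (f.continuous.mul hc)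
  let Λ : C(SU3, ℂ) →ₗ[ℂ] ℂ :=
    { toFun := fun f => ∫ g : SU3, f g * c g ∂haarSU3
      map_add' := fun f f' => by
        simp only [ContinuousMap.add_apply, add_mul]
        exact integral_add (hInt f) (hInt f')
      map_smul' := fun a f => by
        simp only [ContinuousMap.smul_apply, smul_eq_mul, mul_assoc, RingHom.id_apply]
        exact integral_const_mul _ _ }
  have hΛ : Continuous Λ := by
    refine AddMonoidHomClass.continuous_of_bound Λ (∫ g, ‖c g‖ ∂haarSU3) fun f => ?_
    rw [mul_comm, ← integral_const_mul]
    refine norm_integral_le_of_norm_le (integrable_haarSU3 (by fun_prop)) (ae_of_all _ fun g => ?_)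
    rw [norm_mul]
    exact mul_le_mul_of_nonneg_right (f.norm_coe_le_norm g) (norm_nonneg _)
  have hz : (Λ : C(SU3, ℂ) → ℂ) = fun _ => 0 := by
    refine hΛ.ext_on dense_polySU3 continuous_const ?_
    rintro f ⟨F, hF, hFf⟩
    simpa [Λ, ← hFf] using h F hF
  exact congrFun hz f

variable [FiniteDimensional ℂ H]

/-- The matrix coefficients of an irreducible representation are polynomial functions. -/
theorem exists_polyFun_coefficient (hu : ∀ g v, ‖ρ g v‖ = ‖v‖)
    (hc : ∀ v, Continuous fun g => ρ g v) (hirr : ρ.IsIrreducible) (u w : H) :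
    ∃ F ∈ polyFun, ∀ g : SU3, F g = inner ℂ u (ρ g w) := by
  -- The vectors all of whose coefficients are polynomial form an invariant subspace, so by
  -- irreducibility a single nonzero one suffices.
  let V : Submodule ℂ H :=
    { carrier := {u | ∀ w, ∃ F ∈ polyFun, ∀ g : SU3, F g = inner ℂ u (ρ g w)}
      add_mem' := by
        intro u u' h h' w
        obtain ⟨F, hF, hFu⟩ := h w
        obtain ⟨F', hF', hFu'⟩ := h' w
        exact ⟨_, add_mem_polyFun hF hF', fun g => by rw [hFu, hFu', inner_add_left]⟩
      zero_mem' := fun w => ⟨_, const_mem_polyFun 0, fun g => by simp⟩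
      smul_mem' := by
        intro c u h w
        obtain ⟨F, hF, hFu⟩ := h w
        exact ⟨_, mul_mem_polyFun (const_mem_polyFun (starRingEnd ℂ c)) hF, fun g => by
          rw [hFu, inner_smul_left]⟩ }
  have hV : ∀ g, ∀ v ∈ V, ρ g v ∈ V := by
    intro g v hv w
    obtain ⟨F, hF, hFv⟩ := hv w
    refine ⟨_, mul_left_mem_polyFun hF (g⁻¹ : SU3), fun g' => ?_⟩
    have := hFv (g⁻¹ * g')
    rw [inner_rep_left hu, ← Module.End.mul_apply, ← map_mul, ← this]
    rfl
  by_cases hH : ∃ v ∈ V, v ≠ 0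
  · obtain ⟨v, hv, hv0⟩ := hH
    have := eq_top_of_invariant hirr V hV hv hv0
    exact (this ▸ Submodule.mem_top : u ∈ V) w
  push Not at hH
  by_cases hu0 : u = 0
  · exact ⟨_, const_mem_polyFun 0, fun g => by simp [hu0]⟩
  exfalso
  -- averages of the orbit of `u` against polynomial functions lie in `V`
  have hzero : ∀ F ∈ polyFun, ∫ g : SU3, F g * inner ℂ (ρ g u) u ∂haarSU3 = 0 := by
    intro F hF
    let u' : H := ∫ g : SU3, (starRingEnd ℂ (F g)) • ρ g u ∂haarSU3
    have hFc : Continuous fun g : SU3 => F g :=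
      (continuous_of_mem_polyFun hF).comp continuous_subtype_val
    have hInt : Integrable (fun g : SU3 => (starRingEnd ℂ (F g)) • ρ g u) haarSU3 :=
      integrable_haarSU3 ((Complex.continuous_conj.comp hFc).smul (hc u))
    have hu' : ∀ w, inner ℂ u' w = ∫ g : SU3, F g * inner ℂ (ρ g u) w ∂haarSU3 := by
      intro w
      rw [← inner_conj_symm, ← integral_inner hInt w, ← integral_conj]
      congr 1
      ext g
      rw [inner_smul_right, map_mul, Complex.conj_conj, inner_conj_symm]
    obtain ⟨n, p, q, hp, hq, hpq⟩ := exists_sum_of_mem_polyFun hF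
    have hmem : u' ∈ V := by
      intro w
      refine ⟨fun A => ∑ i, p i A * ∫ y : SU3, q i y * inner ℂ (ρ y u) w ∂haarSU3,
        sum_mem_polyFun fun i _ => mul_mem_polyFun (hp i) (const_mem_polyFun _), fun x => ?_⟩
      -- Translating the variable by `x` cancels `ρ x` by unitarity, and `F (x * y)` separates into
      -- polynomials in `x` with coefficients in `y`.
      rw [hu', ← integral_mul_left_eq_self _ x]
      have hq' : ∀ i, Continuous fun g : SU3 => q i g := fun i =>
        (continuous_of_mem_polyFun (hq i)).comp continuous_subtype_val
      simp only [← integral_const_mul]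
      have hcw : Continuous fun g => (inner ℂ (ρ g u) w : ℂ) := (hc u).inner continuous_const
      have hi : ∀ i, Continuous fun y : SU3 => p i x * (q i y * inner ℂ (ρ y u) w) := fun i =>
        continuous_const.mul ((hq' i).mul hcw)
      rw [← integral_finsetSum _ fun i _ => integrable_haarSU3 (hi i)]
      congr 1
      ext y
      have h1 : F ((x * y : SU3) : Mat3) = ∑ i, p i x * q i y := hpq x y
      rw [h1, map_mul, Module.End.mul_apply, inner_rep_rep hu, Finset.sum_mul]
      exact Finset.sum_congr rfl fun i _ => by ring
    rw [← hu', hH u' hmem, inner_zero_left]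
  -- Density makes the coefficient `⟨ρ g u, u⟩` orthogonal to every continuous function. Testing
  -- with its own conjugate gives a zero integral of a function that is positive at the identity.
  have hall := integral_mul_eq_zero_of_polyFun ((hc u).inner continuous_const) hzero
  have hcont : Continuous fun g => inner ℂ u (ρ g u) := continuous_const.inner (hc u)
  have := hall ⟨_, hcont⟩
  have hpos : 0 < ∫ g : SU3, ‖(inner ℂ u (ρ g u) : ℂ)‖ ^ 2 ∂haarSU3 := by
    refine Continuous.integral_pos_of_hasCompactSupport_nonneg_nonzero (by fun_prop)
      (HasCompactSupport.of_compactSpace _) (fun g => by positivity) (x := 1) ?_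
    simpa using hu0
  refine hpos.ne' ?_
  have h2 : ∫ g : SU3, ((‖(inner ℂ u (ρ g u) : ℂ)‖ ^ 2 : ℝ) : ℂ) ∂haarSU3 = 0 := by
    rw [← this]
    congr 1
    ext g
    simp only [ContinuousMap.coe_mk]
    rw [← inner_conj_symm (ρ g u) u, Complex.mul_conj, Complex.normSq_eq_norm_sq]
  rw [integral_complex_ofReal] at h2
  exact_mod_cast h2

end Coefficients

/-! ### Polynomial extension of a representation and its highest weight coefficient -/

section Extension

variable {H : Type*} [NormedAddCommGroup H] [InnerProductSpace ℂ H] {ρ : Representation ℂ SU3 H}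

/-- `R` extends `ρ` to all matrices by polynomial functions. -/
structure IsPolyExtension (ρ : Representation ℂ SU3 H) (R : Mat3 → Module.End ℂ H) : Prop where
  poly : ∀ u w, (fun A => inner ℂ u (R A w)) ∈ polyFun
  coe : ∀ g : SU3, R g = ρ g

variable {R : Mat3 → Module.End ℂ H}

/-- On `SU(3)` this is unitarity. After complex conjugation of the left side, both sides are
polynomial in `A`, so the identity extends to the closure. -/
theorem IsPolyExtension.conjTranspose (hR : IsPolyExtension ρ R) (hu : ∀ g v, ‖ρ g v‖ = ‖v‖)
    {A : Mat3} (hA : A ∈ zariskiSU3) (u w : H) : inner ℂ (R Aᴴ u) w = inner ℂ u (R A w) := by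
  have := hA _ (sub_mem_polyFun (conj_conjTranspose_mem_polyFun (hR.poly w u)) (hR.poly u w))
    fun g => by
      rw [← SU3.coe_inv, hR.coe, hR.coe, inner_conj_symm, inner_rep_left hu, inv_inv, sub_self]
  rwa [inner_conj_symm, sub_eq_zero] at this

theorem IsPolyExtension.diagonal_apply (hR : IsPolyExtension ρ R) {p q : ℕ} {v : H}
    (hv : IsWeightVector ρ p q v) {a b c : ℂ} (h : a * b * c = 1) :
    R (Matrix.diagonal ![a, b, c]) v = (a ^ (p + q) * b ^ q) • v := by
  obtain ⟨z, w, hzw⟩ := exists_expDiag h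
  refine ext_inner_left ℂ fun u => ?_
  have := eq_zero_expDiag (sub_mem_polyFun (hR.poly u v) (mul_mem_polyFun (mul_mem_polyFun
    (pow_mem_polyFun (entry_mem_polyFun 0 0) (p + q)) (pow_mem_polyFun (entry_mem_polyFun 1 1) q))
    (const_mem_polyFun (inner ℂ u v)))) (fun g hg => by
      rw [hR.coe, hv.2 g hg, inner_smul_right, sub_eq_zero]
      norm_cast) z w
  rw [hzw] at this
  rw [inner_smul_right]
  simpa [sub_eq_zero] using this

variable [FiniteDimensional ℂ H]

theorem exists_isPolyExtension (hu : ∀ g v, ‖ρ g v‖ = ‖v‖)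
    (hc : ∀ v, Continuous fun g => ρ g v) (hirr : ρ.IsIrreducible) :
    ∃ R, IsPolyExtension ρ R := by
  let b := stdOrthonormalBasis ℂ H
  choose F hF hFρ using fun i j => exists_polyFun_coefficient hu hc hirr (b i) (b j)
  let R : Mat3 → Module.End ℂ H := fun A => ∑ i, ∑ j, F i j A •
    ((LinearMap.toSpanSingleton ℂ H (b i)) ∘ₗ (innerSL ℂ (b j)).toLinearMap)
  have hRA : ∀ A w, R A w = ∑ i, ∑ j, F i j A • (inner ℂ (b j) w : ℂ) • b i := fun A w => by
    simp [R, LinearMap.sum_apply]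
  refine ⟨R, fun u w => ?_, fun g => LinearMap.ext fun w => ?_⟩
  · simp only [hRA, inner_sum, inner_smul_right]
    exact sum_mem_polyFun fun i _ => sum_mem_polyFun fun j _ =>
      mul_mem_polyFun (hF i j) (const_mem_polyFun _)
  · rw [hRA]
    calc ∑ i, ∑ j, F i j g • (inner ℂ (b j) w : ℂ) • b i
        = ∑ i, (inner ℂ (b i) (ρ g w) : ℂ) • b i := by
          refine Finset.sum_congr rfl fun i _ => ?_
          conv_rhs => rw [← b.sum_repr' w]
          simp only [map_sum, map_smul, inner_sum, inner_smul_right, Finset.sum_smul, hFρ,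
            smul_smul]
          exact Finset.sum_congr rfl fun j _ => by rw [mul_comm]
      _ = ρ g w := b.sum_repr' _

theorem IsPolyExtension.mul (hR : IsPolyExtension ρ R) {A B : Mat3} (hA : A ∈ zariskiSU3)
    (hB : B ∈ zariskiSU3) : R (A * B) = R A * R B := by
  refine LinearMap.ext fun w => ext_inner_left ℂ fun u => ?_
  have h1 : ∀ (u w : H) (g : SU3), inner ℂ u (R (A * g) w) = inner ℂ u (R A (ρ g w)) := by
    intro u w g
    refine sub_eq_zero.1 (hA _ (sub_mem_polyFun (mul_right_mem_polyFun (hR.poly u w) g)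
      (hR.poly u (ρ g w))) fun g' => ?_)
    have : R ((g' * g : SU3) : Mat3) = R g' * R g := by simp only [hR.coe, map_mul]
    rw [sub_eq_zero, ← hR.coe g, ← Module.End.mul_apply, ← this]
    rfl
  rw [Module.End.mul_apply, ← LinearMap.adjoint_inner_left (R A)]
  refine sub_eq_zero.1 (hB _ (sub_mem_polyFun (mul_left_mem_polyFun (hR.poly u w) A)
    (hR.poly (LinearMap.adjoint (R A) u) w)) fun g => ?_)
  rw [sub_eq_zero, LinearMap.adjoint_inner_left, h1, hR.coe]

theorem IsPolyExtension.differentiable (hR : IsPolyExtension ρ R) {c : ℂ → Mat3}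
    (hc : ∀ i j, Differentiable ℂ fun z => c z i j) (w : H) :
    Differentiable ℂ fun z => R (c z) w := by
  let b := stdOrthonormalBasis ℂ H
  have : (fun z => R (c z) w) = fun z => ∑ i, (inner ℂ (b i) (R (c z) w) : ℂ) • b i :=
    funext fun z => (b.sum_repr' _).symm
  rw [this]
  exact Differentiable.fun_sum fun i _ =>
    (differentiable_comp_of_mem_polyFun (hR.poly (b i) w) hc).smul_const _

theorem iteratedDeriv_linearMap_comp (L : Module.End ℂ H) {h : ℂ → H} (hh : Differentiable ℂ h)
    (n : ℕ) : iteratedDeriv n (fun z => L (h z)) = fun z => L (iteratedDeriv n h z) := by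
  induction n with
  | zero => simp
  | succ n ih =>
    rw [iteratedDeriv_succ, ih]
    ext z
    have hd : DifferentiableAt ℂ (iteratedDeriv n h) z :=
      ((hh.contDiff (n := ((n + 1 : ℕ) : WithTop ℕ∞))).differentiable_iteratedDeriv n
        (by exact_mod_cast n.lt_succ_self)) z
    rw [iteratedDeriv_succ]
    exact ((LinearMap.toContinuousLinearMap L).hasFDerivAt.comp_hasDerivAt z
      hd.hasDerivAt).deriv

/-- The exponents of `g₀₀` and `g₁₁` in the positive root `g_ii / g_jj`. -/
theorem exists_root_exponents {i j : Fin 3} (hij : i < j) : ∃ a b : ℤ,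
    (∀ g : SU3, (g : Mat3).IsDiag → (g : Mat3) 0 0 ≠ 0 ∧ (g : Mat3) 1 1 ≠ 0 ∧
      (g : Mat3) i i / (g : Mat3) j j = (g : Mat3) 0 0 ^ (a + b) * (g : Mat3) 1 1 ^ b) ∧
    ∀ (k : ℕ) (p q k' l' : ℕ), 0 < k → (p : ℤ) + k * a = p - 2 * k' + l' →
      (q : ℤ) + k * b = q + k' - 2 * l' → False := by
  have hdet : ∀ g : SU3, (g : Mat3).IsDiag →
      (g : Mat3) 0 0 * (g : Mat3) 1 1 * (g : Mat3) 2 2 = 1 := by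
    intro g hg
    have := SU3.det_eq_one g
    rw [Matrix.det_fin_three, hg (i := 0) (j := 1) (by decide), hg (i := 0) (j := 2) (by decide),
      hg (i := 1) (j := 2) (by decide)] at this
    linear_combination this
  have hne : ∀ g : SU3, (g : Mat3).IsDiag →
      (g : Mat3) 0 0 ≠ 0 ∧ (g : Mat3) 1 1 ≠ 0 ∧ (g : Mat3) 2 2 ≠ 0 := by
    intro g hg
    have := hdet g hg
    refine ⟨?_, ?_, ?_⟩ <;> intro h <;> simp [h] at this
  -- In the basis of fundamental weights the positive roots are `(2, -1)`, `(1, 1)` and `(-1, 2)`.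
  -- Integer arithmetic shows that a positive multiple of a root added to the highest weight never
  -- lies below it.
  fin_cases i <;> fin_cases j <;> simp at hij
  · refine ⟨2, -1, fun g hg => ⟨(hne g hg).1, (hne g hg).2.1, ?_⟩, fun k p q k' l' => by lia⟩
    simp [div_eq_mul_inv]
  · refine ⟨1, 1, fun g hg => ⟨(hne g hg).1, (hne g hg).2.1, ?_⟩, fun k p q k' l' => by lia⟩
    have h2 := (hne g hg).2.2
    change (g : Mat3) 0 0 / (g : Mat3) 2 2 = (g : Mat3) 0 0 ^ (2 : ℕ) * (g : Mat3) 1 1 ^ (1 : ℤ)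
    rw [zpow_one]
    field_simp
    linear_combination (-(g : Mat3) 0 0) * (hdet g hg)
  · refine ⟨-1, 2, fun g hg => ⟨(hne g hg).1, (hne g hg).2.1, ?_⟩, fun k p q k' l' => by lia⟩
    have h2 := (hne g hg).2.2
    change (g : Mat3) 1 1 / (g : Mat3) 2 2 = (g : Mat3) 0 0 ^ (1 : ℤ) * (g : Mat3) 1 1 ^ (2 : ℕ)
    rw [zpow_one]
    field_simp
    linear_combination (-(g : Mat3) 1 1) * (hdet g hg)

/-- The highest weight vector is invariant under upper triangular elementary matrices. -/
theorem IsPolyExtension.transvection_apply (hR : IsPolyExtension ρ R) {p q : ℕ}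
    (hρ : IsQuarkSystem p q ρ) {v : H} (hv : IsWeightVector ρ p q v) {i j : Fin 3} (hij : i < j)
    (z : ℂ) : R (Matrix.transvection i j z) v = v := by
  let h : ℂ → H := fun z => R (Matrix.transvection i j z) v
  have hd : Differentiable ℂ h := hR.differentiable (fun k l => by
    simp only [Matrix.transvection, Matrix.add_apply, Matrix.single_apply]
    split_ifs <;> fun_prop) v
  obtain ⟨a, b, hab, hcon⟩ := exists_root_exponents hij
  -- A nonzero `n`-th Taylor coefficient would be a weight vector whose weight is the highest one
  -- plus `n` times a positive root.
  have hzero : ∀ n, 0 < n → iteratedDeriv n h 0 = 0 := by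
    intro n hn
    by_contra hne
    obtain ⟨k', l', h1, h2⟩ := hρ.highest (p + n * a) (q + n * b) ⟨iteratedDeriv n h 0, hne, by
      intro g hg
      obtain ⟨h0, h1, hα⟩ := hab g hg
      set χ : ℂ := (g : Mat3) 0 0 ^ ((p : ℤ) + q) * (g : Mat3) 1 1 ^ (q : ℤ) with hχ
      set α : ℂ := (g : Mat3) i i / (g : Mat3) j j with hα'
      have hdiag : (g : Mat3) = Matrix.diagonal fun k => (g : Mat3) k k :=
        hg.diagonal_diag.symm
      have hgj : (g : Mat3) j j ≠ 0 := by
        have hdet := SU3.det_eq_one g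
        rw [hdiag, Matrix.det_diagonal] at hdet
        intro h0
        exact zero_ne_one
          ((Finset.prod_eq_zero (f := fun k => (g : Mat3) k k) (Finset.mem_univ j) h0).symm.trans hdet)
      have hcomm : ∀ z, (g : Mat3) * Matrix.transvection i j z =
          Matrix.transvection i j (α * z) * g := by
        intro z
        rw [hdiag]
        ext k l
        rw [Matrix.mul_diagonal, Matrix.diagonal_mul]
        simp only [Matrix.transvection, Matrix.add_apply, Matrix.single_apply, Matrix.one_apply]
        rcases eq_or_ne k l with rfl | hkl
        · rcases eq_or_ne i k with rfl | hik
          · simp [hij.ne']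
          · simp [hik]
        · simp only [hkl, if_false]
          split_ifs with hkl'
          · rw [← hkl'.1, ← hkl'.2, hα']
            field_simp
            ring
          · simp
      -- Moving a torus element past the transvection rescales its parameter by the root character
      -- `α`, and the torus element acts on `v` by `χ`. Each derivative at zero contributes one
      -- factor `α`.
      have hρh : (fun z => ρ g (h z)) = fun z => χ • h (α * z) := by
        ext z
        have e1 := hR.mul (coe_mem_zariskiSU3 g) (transvection_mem_zariskiSU3 hij z)
        have e2 := hR.mul (transvection_mem_zariskiSU3 hij (α * z)) (coe_mem_zariskiSU3 g)
        rw [hcomm, e2, hR.coe] at e1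
        have e3 := LinearMap.congr_fun e1 v
        rw [Module.End.mul_apply, Module.End.mul_apply, hv.2 g hg, map_smul] at e3
        exact e3.symm
      have hder := congrFun (iteratedDeriv_linearMap_comp (ρ g) hd n) 0
      rw [hρh] at hder
      have hcd : ContDiffAt ℂ n (fun z => h (α * z)) 0 :=
        (hd.comp (differentiable_id.const_mul α)).contDiff.contDiffAt
      rw [← hder, iteratedDeriv_fun_const_smul hcd χ, iteratedDeriv_comp_const_smul hd.contDiff]
      simp only [mul_zero, smul_smul]
      rw [hα, hχ]
      congr 1
      have e0 : ∀ (x : ℂ) (c d : ℤ), x ≠ 0 → x ^ c * (x ^ d) ^ n = x ^ (c + n * d) := by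
        intro x c d hx
        rw [zpow_add₀ hx, mul_comm (n : ℤ), zpow_mul, zpow_natCast]
      rw [mul_pow, mul_mul_mul_comm, e0 _ _ _ h0, e0 _ _ _ h1]
      congr 2
      ring⟩
    exact hcon n p q k' l' hn h1 h2
  have hs := Complex.hasSum_taylorSeries_of_entire hd 0 z
  have hs' := hasSum_single (f := fun n : ℕ =>
    ((n.factorial : ℂ))⁻¹ • (z - 0) ^ n • iteratedDeriv n h 0) 0 fun n hn => by
      simp only [hzero n (Nat.pos_of_ne_zero hn), smul_zero]
  have := hs.unique hs'
  have h1 : R 1 v = v := by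
    have := hR.coe 1
    rw [map_one] at this
    exact LinearMap.congr_fun this v
  simpa [h, h1] using this

theorem IsPolyExtension.unipotent_apply (hR : IsPolyExtension ρ R) {p q : ℕ}
    (hρ : IsQuarkSystem p q ρ) {v : H} (hv : IsWeightVector ρ p q v) (x y z : ℂ) :
    R (unipotent x y z) v = v := by
  rw [unipotent, hR.mul (mul_mem_zariskiSU3 (transvection_mem_zariskiSU3 (by decide) x)
    (transvection_mem_zariskiSU3 (by decide) y)) (transvection_mem_zariskiSU3 (by decide) z),
    hR.mul (transvection_mem_zariskiSU3 (by decide) x)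
      (transvection_mem_zariskiSU3 (by decide) y), Module.End.mul_apply, Module.End.mul_apply,
    hR.transvection_apply hρ hv (by decide), hR.transvection_apply hρ hv (by decide),
    hR.transvection_apply hρ hv (by decide)]

/-- The diagonal matrix coefficient of a highest weight vector. -/
theorem inner_highestWeight {p q : ℕ} (hρ : IsQuarkSystem p q ρ) {v : H}
    (hv : IsWeightVector ρ p q v) (g : SU3) :
    inner ℂ v (ρ g v) = (g : Mat3) 0 0 ^ p * minor₂ g ^ q * inner ℂ v v := by
  obtain ⟨R, hR⟩ := exists_isPolyExtension hρ.unitary hρ.continuous hρ.irreducible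
  have hF : (fun A => inner ℂ v (R A v) - A 0 0 ^ p * minor₂ A ^ q * inner ℂ v v) ∈ polyFun :=
    sub_mem_polyFun (hR.poly v v) (mul_mem_polyFun (mul_mem_polyFun
      (pow_mem_polyFun (entry_mem_polyFun 0 0) p) (pow_mem_polyFun minor₂_mem_polyFun q))
      (const_mem_polyFun _))
  have := eq_zero_of_generic (continuous_of_mem_polyFun hF) (fun A hA h₁ h₂ => by
    obtain ⟨x, y, z, x', y', z', hLDU⟩ :=
      exists_gauss_decomposition (det_eq_one_of_mem_zariskiSU3 hA) h₁ h₂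
    have hd : A 0 0 * (minor₂ A / A 0 0) * (1 / minor₂ A) = 1 := by field_simp
    have hL := conjTranspose_mem_zariskiSU3 (unipotent_mem_zariskiSU3 x y z)
    have hRA : R A v = R (unipotent x y z)ᴴ (R (Matrix.diagonal
        ![A 0 0, minor₂ A / A 0 0, 1 / minor₂ A]) (R (unipotent x' y' z') v)) := by
      conv_lhs => rw [hLDU]
      rw [hR.mul (mul_mem_zariskiSU3 hL (diagonal_mem_zariskiSU3 hd))
        (unipotent_mem_zariskiSU3 _ _ _), hR.mul hL (diagonal_mem_zariskiSU3 hd)]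
      rfl
    -- The lower unipotent factor moves to the left argument as an upper one. Both unipotent factors
    -- then fix `v`, and only the scalar of the diagonal factor is left.
    rw [hRA, ← hR.conjTranspose hρ.unitary hL, Matrix.conjTranspose_conjTranspose,
      hR.unipotent_apply hρ hv, hR.unipotent_apply hρ hv, hR.diagonal_apply hv hd,
      inner_smul_right, div_pow, pow_add]
    field_simp
    ring) (coe_mem_zariskiSU3 g)
  rw [hR.coe] at this
  exact sub_eq_zero.1 this

end Extension

/-! ### Functions on the orbit -/

section Orbit

variable {ξ : Mat3}

theorem ad_orbitPoint (g h : SU3) : ad ξ g (orbitPoint ξ h) = orbitPoint ξ (g * h) :=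
  Subtype.ext (by simp [ad, orbitPoint, Matrix.mul_assoc, Matrix.conjTranspose_mul])

theorem orbitPoint_surjective : Function.Surjective (orbitPoint ξ) := by
  rintro ⟨_, g, rfl⟩
  exact ⟨g, rfl⟩

theorem continuous_orbitPoint : Continuous (orbitPoint ξ) := by
  refine Continuous.subtype_mk ?_ _
  exact (continuous_subtype_val.matrix_mul continuous_const).matrix_mul
    continuous_subtype_val.matrix_conjTranspose

theorem continuous_orbitPoly (f : OrbitPoly ξ) : Continuous (f : orbit ξ → ℂ) := by
  obtain ⟨_, P, rfl⟩ := f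
  change Continuous (restrict ξ P)
  have hcoord : ∀ j, Continuous fun x : orbit ξ => coord (x : Mat3) j := fun j =>
    (continuous_const.matrix_mul continuous_subtype_val).matrix_trace
  induction P using MvPolynomial.induction_on with
  | C a => simpa [restrict, Pi.algebraMap_def] using continuous_const
  | add p q hp hq => simpa using hp.add hq
  | mul_X p j hp => simpa [restrict] using hp.mul (hcoord j)

theorem continuous_orbitPoly_orbitPoint (f : OrbitPoly ξ) :
    Continuous fun g => (f : orbit ξ → ℂ) (orbitPoint ξ g) :=
  (continuous_orbitPoly f).comp continuous_orbitPoint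

theorem bddAbove_norm_orbitPoly (f : OrbitPoly ξ) :
    BddAbove (Set.range fun x : orbit ξ => ‖(f : orbit ξ → ℂ) x‖) := by
  have : CompactSpace (orbit ξ) :=
    isCompact_iff_compactSpace.1 (isCompact_range (continuous_subtype_val.comp
      (continuous_orbitPoint (ξ := ξ))))
  exact (isCompact_range (continuous_orbitPoly f).norm).bddAbove

theorem norm_orbitIntegral_le (f : OrbitPoly ξ) :
    ‖orbitIntegral (f : orbit ξ → ℂ)‖ ≤ supNorm f := by
  refine (norm_integral_le_of_norm_le_const (C := supNorm f) (ae_of_all _ fun g => ?_)).trans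
    (by simp)
  exact le_ciSup (bddAbove_norm_orbitPoly f) (orbitPoint ξ g)

theorem orbitIntegral_sub (f f' : OrbitPoly ξ) :
    orbitIntegral ((f - f' : OrbitPoly ξ) : orbit ξ → ℂ) =
      orbitIntegral (f : orbit ξ → ℂ) - orbitIntegral (f' : orbit ξ → ℂ) :=
  integral_sub (integrable_haarSU3 (continuous_orbitPoly_orbitPoint f))
    (integrable_haarSU3 (continuous_orbitPoly_orbitPoint f'))

theorem orbitInner_sum_right {ι : Type*} (s : Finset ι) (f : OrbitPoly ξ) (c : ι → ℂ)
    (F : ι → OrbitPoly ξ) :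
    orbitInner f (∑ i ∈ s, c i • F i) = ∑ i ∈ s, c i * orbitInner f (F i) := by
  simp only [orbitInner, orbitIntegral, ← integral_const_mul]
  rw [← integral_finsetSum]
  · congr 1
    ext g
    simp only [AddSubmonoidClass.coe_finsetSum, Finset.sum_apply, Finset.mul_sum]
    exact Finset.sum_congr rfl fun i _ => by
      change _ * (c i * _) = _
      ring
  · intro i _
    exact integrable_haarSU3 (continuous_const.mul ((Complex.continuous_conj.comp
      (continuous_orbitPoly_orbitPoint f)).mul (continuous_orbitPoly_orbitPoint (F i))))

/-! ### Stabilizers of dominant weights -/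

theorem smul_E_seven {a b : ℝ} (h : a = b * √2 * √3) :
    ((a : ℝ) : ℂ) • E 7 = (b * Complex.I) • (!![1, 0, 0; 0, 1, 0; 0, 0, -2] : Mat3) := by
  have h2 : ((√2 : ℝ) : ℂ) ≠ 0 := by norm_num
  have h3 : ((√3 : ℝ) : ℂ) ≠ 0 := by norm_num
  have : gellMann 7 = ((√3 : ℝ) : ℂ)⁻¹ • (!![1, 0, 0; 0, 1, 0; 0, 0, -2] : Mat3) := rfl
  rw [E, this, smul_smul, smul_smul, h]
  congr 1
  push_cast
  field_simp

theorem domWeight_eq_diagonal (p q : ℕ) : domWeight p q = Matrix.diagonal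
    ![Complex.I * ((2 * p + q) / 3), Complex.I * ((q - p) / 3),
      -(Complex.I * ((p + 2 * q) / 3))] := by
  have h22 : √2 * √2 = 2 := Real.mul_self_sqrt (by norm_num)
  have h33 : √3 * √3 = 3 := Real.mul_self_sqrt (by norm_num)
  have h6 : √6 = √2 * √3 := by rw [← Real.sqrt_mul (by norm_num)]; norm_num
  have e1 : ((1 / √2 : ℝ) : ℂ) • E 2 =
      (Complex.I / 2) • (!![1, 0, 0; 0, -1, 0; 0, 0, 0] : Mat3) := by
    have : gellMann 2 = (!![1, 0, 0; 0, -1, 0; 0, 0, 0] : Mat3) := rfl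
    rw [E, this, smul_smul]
    congr 1
    have h22' : ((√2 : ℝ) : ℂ) * ((√2 : ℝ) : ℂ) = 2 := by exact_mod_cast h22
    have h2 : ((√2 : ℝ) : ℂ) ≠ 0 := by norm_num
    push_cast
    field_simp
    linear_combination -h22'
  have e2 := smul_E_seven (a := 1 / √6) (b := 1 / 6) (by
    rw [h6]
    field_simp
    nlinarith)
  have e3 := smul_E_seven (a := √(2 / 3)) (b := 1 / 3) (by
    rw [Real.sqrt_div (by norm_num)]
    field_simp
    nlinarith)
  rw [domWeight, fundWeight₁, fundWeight₂, e1, e2, e3]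
  ext k l
  fin_cases k <;> fin_cases l <;> simp <;> ring

/-- A nonzero dominant weight has squared norm `2/3 * (p² + p q + q²) ≥ 2/3`, so the admissible
scalars stay away from zero; `1/3` is a convenient lower bound. -/
theorem intRadius_pos (hξ : ξ ∈ rationalPoints) : 0 < intRadius ξ := by
  refine lt_of_lt_of_le (by norm_num : (0 : ℝ) < 1 / 3) (le_csInf hξ.2 ?_)
  rintro R ⟨hR, p, q, hpq⟩
  have h1 : (((R : ℂ) • ξ)ᴴ * ((R : ℂ) • ξ)).trace = (R : ℂ) ^ 2 := by
    rw [Matrix.conjTranspose_smul, Matrix.smul_mul, Matrix.mul_smul, smul_smul, Matrix.trace_smul,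
      hξ.1]
    simp [sq]
  rw [hpq, domWeight_eq_diagonal, Matrix.diagonal_conjTranspose, Matrix.diagonal_mul_diagonal,
    Matrix.trace_diagonal, Fin.sum_univ_three] at h1
  have h2 : (R : ℂ) ^ 2 = ((((2 * p + q) ^ 2 + (q - p) ^ 2 + (p + 2 * q) ^ 2) / 9 : ℝ) : ℂ) := by
    rw [← h1]
    simp
    linear_combination (-((2 * p + q) ^ 2 + (q - p) ^ 2 + (p + 2 * q) ^ 2) / 9 : ℂ) *
      Complex.I_sq
  have h3 : R ^ 2 = ((2 * p + q) ^ 2 + (q - p) ^ 2 + (p + 2 * q) ^ 2) / 9 := by exact_mod_cast h2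
  have hpq0 : 1 ≤ p + q := by
    by_contra hcon
    have hp : p = 0 := by lia
    have hq : q = 0 := by lia
    subst hp hq
    simp at h3
    exact hR.ne' h3
  have hpq1 : (1 : ℝ) ≤ p + q := by exact_mod_cast hpq0
  have hp0 : (0 : ℝ) ≤ p := p.cast_nonneg
  have hq0 : (0 : ℝ) ≤ q := q.cast_nonneg
  nlinarith [sq_nonneg ((q : ℝ) - p)]

theorem SU3.sum_row (g : SU3) (k : Fin 3) : ∑ l, ‖(g : Mat3) k l‖ ^ 2 = 1 := by
  have h := congrFun (congrFun (SU3.mul_conjTranspose g) k) k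
  rw [Matrix.mul_apply] at h
  simp only [Matrix.conjTranspose_apply, Complex.star_def, Complex.mul_conj,
    Complex.normSq_eq_norm_sq, Matrix.one_apply_eq] at h
  exact_mod_cast h

theorem SU3.norm_le_one (g : SU3) (k l : Fin 3) : ‖(g : Mat3) k l‖ ≤ 1 :=
  entry_norm_bound_of_unitary g.2.1 k l

theorem SU3.row_eq_zero (g : SU3) {k l : Fin 3} (h : ‖(g : Mat3) k k‖ = 1) (hkl : k ≠ l) :
    (g : Mat3) k l = 0 := by
  have hs := SU3.sum_row g k
  have hle : ‖(g : Mat3) k k‖ ^ 2 + ‖(g : Mat3) k l‖ ^ 2 ≤ ∑ l, ‖(g : Mat3) k l‖ ^ 2 := by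
    rw [← Finset.sum_pair hkl (f := fun l => ‖(g : Mat3) k l‖ ^ 2)]
    exact Finset.sum_le_sum_of_subset_of_nonneg (Finset.subset_univ _) fun _ _ _ => by positivity
  rw [hs, h] at hle
  have : ‖(g : Mat3) k l‖ ^ 2 = 0 := le_antisymm (by linarith) (by positivity)
  simpa using this

theorem SU3.column_eq_zero (g : SU3) {k l : Fin 3} (h : ‖(g : Mat3) k k‖ = 1) (hkl : k ≠ l) :
    (g : Mat3) l k = 0 := by
  have := SU3.row_eq_zero g⁻¹ (k := k) (l := l) (by simpa [SU3.coe_inv] using h) hkl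
  simpa [SU3.coe_inv] using this

theorem SU3.norm_minor₂ (g : SU3) : ‖minor₂ g‖ = ‖(g : Mat3) 2 2‖ := by
  have h := congrFun (congrFun (SU3.adjugate g) 2) 2
  rw [Matrix.adjugate_fin_three] at h
  simp only [Matrix.of_apply, Matrix.cons_val, Matrix.conjTranspose_apply] at h
  rw [minor₂, h, norm_star]

/-- A unitary matrix whose leading principal minors have modulus one where the coefficients of
the weight do not vanish fixes the weight. -/
theorem conj_domWeight {p q : ℕ} (g : SU3) (hp : p ≠ 0 → ‖(g : Mat3) 0 0‖ = 1)
    (hq : q ≠ 0 → ‖minor₂ g‖ = 1) :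
    (g : Mat3) * domWeight p q * (g : Mat3)ᴴ = domWeight p q := by
  -- Up to sign, the differences of the diagonal entries of the weight are `i p`, `i q` and `i (p +
  -- q)`, so only the products of the entries of `g` with `p` and `q` matter. A diagonal entry of
  -- modulus one clears the rest of its row and column, and `minor₂ g` has the modulus of the last
  -- diagonal entry.
  have hcomm : (g : Mat3) * domWeight p q = domWeight p q * g := by
    have hp' : ∀ l : Fin 3, 0 ≠ l → (p : ℂ) * (g : Mat3) 0 l = 0 ∧ (p : ℂ) * (g : Mat3) l 0 = 0 := by
      intro l hl
      rcases eq_or_ne p 0 with rfl | h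
      · simp
      · simp [SU3.row_eq_zero g (hp h) hl, SU3.column_eq_zero g (hp h) hl]
    have hq' : ∀ l : Fin 3, 2 ≠ l → (q : ℂ) * (g : Mat3) 2 l = 0 ∧ (q : ℂ) * (g : Mat3) l 2 = 0 := by
      intro l hl
      rcases eq_or_ne q 0 with rfl | h
      · simp
      · have h' := SU3.norm_minor₂ g ▸ hq h
        simp [SU3.row_eq_zero g h' hl, SU3.column_eq_zero g h' hl]
    obtain ⟨p01, p10⟩ := hp' 1 (by decide)
    obtain ⟨p02, p20⟩ := hp' 2 (by decide)
    obtain ⟨q20, q02⟩ := hq' 0 (by decide)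
    obtain ⟨q21, q12⟩ := hq' 1 (by decide)
    rw [domWeight_eq_diagonal]
    ext k l
    rw [Matrix.mul_diagonal, Matrix.diagonal_mul]
    fin_cases k <;> fin_cases l <;> simp
    · ring
    · linear_combination (-Complex.I) * p01
    · linear_combination (-Complex.I) * (p02 + q02)
    · linear_combination Complex.I * p10
    · ring
    · linear_combination (-Complex.I) * q12
    · linear_combination Complex.I * (p20 + q20)
    · linear_combination Complex.I * q21
    · ring
  rw [hcomm, Matrix.mul_assoc, SU3.mul_conjTranspose, Matrix.mul_one]

end Orbit

/-! ### Concentration -/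

/-- Powers of a continuous function with values in `[0, 1]` concentrate on the set where it is
one. -/
theorem tendsto_integral_pow {φ : SU3 → ℝ} (hφ : Continuous φ) (h0 : ∀ g, 0 ≤ φ g)
    (h1 : ∀ g, φ g ≤ 1) (hone : φ 1 = 1) {f : SU3 → ℂ} (hf : Continuous f)
    (hfφ : ∀ g, φ g = 1 → f g = f 1) :
    Tendsto (fun s : ℕ => (∫ g, f g * (φ g ^ s : ℝ) ∂haarSU3) / (∫ g, φ g ^ s ∂haarSU3 : ℝ))
      atTop (𝓝 (f 1)) := by
  have hI : ∀ s : ℕ, 0 < ∫ g, φ g ^ s ∂haarSU3 := fun s =>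
    Continuous.integral_pos_of_hasCompactSupport_nonneg_nonzero (hφ.pow s)
      (HasCompactSupport.of_compactSpace _) (fun g => pow_nonneg (h0 g) s) (x := 1) (by simp [hone])
  have hφs : ∀ s : ℕ, Continuous fun g => φ g ^ s := fun s => hφ.pow s
  rw [Metric.tendsto_atTop']
  intro ε hε
  obtain ⟨M, hM⟩ : ∃ M, ∀ g, ‖f g - f 1‖ ≤ M := by
    obtain ⟨M, hM⟩ := (isCompact_range (hf.sub continuous_const).norm).bddAbove
    exact ⟨M, fun g => hM ⟨g, rfl⟩⟩
  have hM0 : 0 ≤ M := (norm_nonneg _).trans (hM 1)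
  obtain ⟨c, hc0, hc1, hc⟩ : ∃ c, 0 ≤ c ∧ c < 1 ∧ ∀ g, ε / 2 ≤ ‖f g - f 1‖ → φ g ≤ c := by
    have hcpt : IsCompact {g | ε / 2 ≤ ‖f g - f 1‖} :=
      (isClosed_le continuous_const (hf.sub continuous_const).norm).isCompact
    rcases Set.eq_empty_or_nonempty {g | ε / 2 ≤ ‖f g - f 1‖} with he | hne
    · refine ⟨0, le_rfl, one_pos, fun g hg => ?_⟩
      have : g ∈ {g | ε / 2 ≤ ‖f g - f 1‖} := hg
      simp [he] at this
    · obtain ⟨g₀, hg₀, hmax⟩ := hcpt.exists_isMaxOn hne hφ.continuousOn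
      refine ⟨φ g₀, h0 g₀, lt_of_le_of_ne (h1 g₀) fun h => ?_, fun g hg => hmax hg⟩
      have h' : ε / 2 ≤ ‖f g₀ - f 1‖ := hg₀
      rw [hfφ g₀ h, sub_self, norm_zero] at h'
      linarith
  -- The set where `φ > c'` is an open neighbourhood of the identity, so the denominator is at least
  -- a constant times `c' ^ s`. The part of the numerator far from `f 1` is at most `M * c ^ s`,
  -- which is negligible.
  obtain ⟨c', hcc', hc'1⟩ := exists_between hc1
  have hc'0 : 0 < c' := hc0.trans_lt hcc'
  set U : Set SU3 := {g | c' < φ g} with hU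
  have hUo : IsOpen U := isOpen_lt continuous_const hφ
  have hUpos : 0 < haarSU3.real U := by
    have := hUo.measure_pos haarSU3 ⟨1, by simpa [hU, hone] using hc'1⟩
    exact ENNReal.toReal_pos this.ne' (measure_ne_top _ _)
  have hlow : ∀ s : ℕ, c' ^ s * haarSU3.real U ≤ ∫ g, φ g ^ s ∂haarSU3 := by
    intro s
    have hInt := integrable_haarSU3 (hφs s)
    calc c' ^ s * haarSU3.real U ≤ ∫ g in U, φ g ^ s ∂haarSU3 :=
          setIntegral_ge_of_const_le_real hUo.measurableSet (measure_ne_top _ _)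
            (fun g hg => pow_le_pow_left₀ hc'0.le (le_of_lt hg) s) hInt.integrableOn
      _ ≤ _ := setIntegral_le_integral hInt (ae_of_all _ fun g => pow_nonneg (h0 g) s)
  have hlim : Tendsto (fun s : ℕ => M * (c / c') ^ s / haarSU3.real U) atTop (𝓝 0) := by
    have := tendsto_pow_atTop_nhds_zero_of_lt_one (div_nonneg hc0 hc'0.le)
      ((div_lt_one hc'0).2 hcc')
    simpa using (this.const_mul M).div_const (haarSU3.real U)
  obtain ⟨N, hN⟩ := eventually_atTop.1 (hlim.eventually_lt_const (half_pos hε))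
  refine ⟨N, fun s hs => ?_⟩
  have hIs := hI s
  set I := ∫ g, φ g ^ s ∂haarSU3 with hIdef
  have hsub : (∫ g, f g * (φ g ^ s : ℝ) ∂haarSU3) - f 1 * (I : ℂ) =
      ∫ g, (f g - f 1) * (φ g ^ s : ℝ) ∂haarSU3 := by
    rw [hIdef, ← integral_complex_ofReal, ← integral_const_mul, ← integral_sub]
    · simp only [sub_mul]
    · exact integrable_haarSU3 (hf.mul (Complex.continuous_ofReal.comp (hφs s)))
    · exact integrable_haarSU3 (continuous_const.mul (Complex.continuous_ofReal.comp (hφs s)))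
  have hbound : ‖∫ g, (f g - f 1) * (φ g ^ s : ℝ) ∂haarSU3‖ ≤ ε / 2 * I + M * c ^ s := by
    have hInt2 : Integrable (fun g => ε / 2 * φ g ^ s + M * c ^ s) haarSU3 :=
      integrable_haarSU3 (by fun_prop)
    refine (norm_integral_le_of_norm_le hInt2 (ae_of_all _ fun g => ?_)).trans (le_of_eq ?_)
    · have hp := pow_nonneg (h0 g) s
      rw [norm_mul, Complex.norm_real, Real.norm_of_nonneg hp]
      have hcs : 0 ≤ M * c ^ s := by positivity
      rcases le_or_gt (ε / 2) ‖f g - f 1‖ with h | h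
      · have := mul_le_mul (hM g) (pow_le_pow_left₀ (h0 g) (hc g h) s) hp hM0
        have : 0 ≤ ε / 2 * φ g ^ s := by positivity
        linarith
      · have := mul_le_mul_of_nonneg_right h.le hp
        linarith
    · rw [integral_add (integrable_haarSU3 (by fun_prop)) (integrable_const _), integral_const_mul]
      simp [hIdef]
  have hI' : (I : ℂ) ≠ 0 := by exact_mod_cast hIs.ne'
  rw [dist_eq_norm, div_sub' hI', mul_comm (I : ℂ), hsub, norm_div, Complex.norm_real,
    Real.norm_of_nonneg hIs.le, div_lt_iff₀ hIs]
  have hsmall : M * c ^ s < ε / 2 * I := by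
    have h2 := hN s (le_of_lt hs)
    rw [div_lt_iff₀ hUpos, div_pow, mul_div_assoc', div_lt_iff₀ (pow_pos hc'0 s)] at h2
    have h3 := mul_le_mul_of_nonneg_left (hlow s) (half_pos hε).le
    linarith
  linarith

/-! ### Coherent state quantization of intertwiners -/

section Coherent

variable {K : Type*} [NormedAddCommGroup K] [InnerProductSpace ℂ K]
  {H : Type*} [NormedAddCommGroup H] [InnerProductSpace ℂ H] {ξ : Mat3}
  {ρ : Representation ℂ SU3 H} {π : Representation ℂ SU3 K}

theorem continuous_coherent (hc : ∀ v, Continuous fun g => ρ g v) (v w : H) (f : OrbitPoly ξ) :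
    Continuous fun g => ((f : orbit ξ → ℂ) (orbitPoint ξ g) * inner ℂ (ρ g v) w) • ρ g v :=
  ((continuous_orbitPoly_orbitPoint f).mul ((hc v).inner continuous_const)).smul (hc v)

/-- The integral of a family of functions on the orbit against the projections to the
translates of `v`. -/
def coherentMap (hc : ∀ v, Continuous fun g => ρ g v) (v : H) (T : K →ₗ[ℂ] OrbitPoly ξ) :
    K →ₗ[ℂ] Module.End ℂ H :=
  LinearMap.mk₂ ℂ (fun k w => ∫ g, ((T k : orbit ξ → ℂ) (orbitPoint ξ g) *
      inner ℂ (ρ g v) w) • ρ g v ∂haarSU3)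
    (fun k k' w => by
      rw [← integral_add (integrable_haarSU3 (continuous_coherent hc v w _))
        (integrable_haarSU3 (continuous_coherent hc v w _))]
      simp [add_mul, add_smul])
    (fun c k w => by
      rw [← integral_smul]
      simp [smul_smul, mul_assoc])
    (fun k w w' => by
      rw [← integral_add (integrable_haarSU3 (continuous_coherent hc v w _))
        (integrable_haarSU3 (continuous_coherent hc v w' _))]
      simp [mul_add, add_smul])
    (fun c k w => by
      rw [← integral_smul]
      simp [smul_smul, mul_left_comm])

theorem coherentMap_apply (hc : ∀ v, Continuous fun g => ρ g v) (v : H)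
    (T : K →ₗ[ℂ] OrbitPoly ξ) (k : K) (w : H) : coherentMap hc v T k w =
      ∫ g, ((T k : orbit ξ → ℂ) (orbitPoint ξ g) * inner ℂ (ρ g v) w) • ρ g v ∂haarSU3 := rfl

variable [FiniteDimensional ℂ H]

/-- Invariance of Haar measure under left translation turns equivariance of `T` into equivariance of
the operators. -/
theorem isOpIntertwiner_coherentMap (hu : ∀ g v, ‖ρ g v‖ = ‖v‖)
    (hc : ∀ v, Continuous fun g => ρ g v) (v : H) {T : K →ₗ[ℂ] OrbitPoly ξ}
    (hT : IsFunIntertwiner π T) : IsOpIntertwiner π ρ (coherentMap hc v T) := by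
  intro h k
  refine LinearMap.ext fun w => ?_
  have key : ∀ g, ((T (π h k) : orbit ξ → ℂ) (orbitPoint ξ (h * g)) *
      inner ℂ (ρ (h * g) v) w) • ρ (h * g) v = ρ h (((T k : orbit ξ → ℂ) (orbitPoint ξ g) *
        inner ℂ (ρ g v) (ρ h⁻¹ w)) • ρ g v) := by
    intro g
    rw [← ad_orbitPoint, hT h k, map_mul, Module.End.mul_apply, inner_rep_left hu, map_smul]
  rw [coherentMap_apply, ← integral_mul_left_eq_self _ h]
  simp only [key, Module.End.mul_apply, coherentMap_apply]
  exact ContinuousLinearMap.integral_comp_comm (LinearMap.toContinuousLinearMap (ρ h))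
    (integrable_haarSU3 (continuous_coherent hc v (ρ h⁻¹ w) (T k)))

theorem inner_coherentMap (hc : ∀ v, Continuous fun g => ρ g v) (v : H)
    (T : K →ₗ[ℂ] OrbitPoly ξ) (k : K) : inner ℂ v (coherentMap hc v T k v) =
      ∫ g, (T k : orbit ξ → ℂ) (orbitPoint ξ g) *
        ((‖(inner ℂ v (ρ g v) : ℂ)‖ ^ 2 : ℝ) : ℂ) ∂haarSU3 := by
  rw [coherentMap_apply, ← integral_inner (integrable_haarSU3 (continuous_coherent hc v v _))]
  congr 1
  ext g
  rw [inner_smul_right, mul_assoc, ← Complex.normSq_eq_norm_sq, ← Complex.mul_conj,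
    inner_conj_symm, mul_comm (inner ℂ (ρ g v) v)]

end Coherent

/-! ### Multiplicities -/

section Multiplicity

variable {ξ : Mat3} {K : Type*} [NormedAddCommGroup K] [InnerProductSpace ℂ K]
  {π : Representation ℂ SU3 K}

/-- The modulus of the highest weight matrix coefficient. -/
def coherentWeight (p q : ℕ) (g : SU3) : ℝ := (‖(g : Mat3) 0 0‖ ^ p * ‖minor₂ g‖ ^ q) ^ 2

theorem continuous_coherentWeight (p q : ℕ) : Continuous (coherentWeight p q) := by
  have h1 : Continuous fun g : SU3 => (g : Mat3) 0 0 := continuous_subtype_val.matrix_elem 0 0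
  have h2 : Continuous fun g : SU3 => minor₂ g :=
    (continuous_of_mem_polyFun minor₂_mem_polyFun).comp continuous_subtype_val
  exact ((h1.norm.pow p).mul (h2.norm.pow q)).pow 2

theorem coherentWeight_nonneg (p q : ℕ) (g : SU3) : 0 ≤ coherentWeight p q g := by
  unfold coherentWeight; positivity

theorem coherentWeight_le_one (p q : ℕ) (g : SU3) : coherentWeight p q g ≤ 1 := by
  have h2 : ‖minor₂ g‖ ≤ 1 := SU3.norm_minor₂ g ▸ SU3.norm_le_one g 2 2
  exact pow_le_one₀ (by positivity) (mul_le_one₀ (pow_le_one₀ (norm_nonneg _)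
    (SU3.norm_le_one g 0 0)) (by positivity) (pow_le_one₀ (norm_nonneg _) h2))

theorem coherentWeight_one (p q : ℕ) : coherentWeight p q 1 = 1 := by
  simp [coherentWeight, minor₂]

theorem orbitPoint_of_coherentWeight {p q : ℕ} {r : ℝ} (hr : r ≠ 0)
    (hω : domWeight p q = (r : ℂ) • ξ) {g : SU3} (hg : coherentWeight p q g = 1) :
    orbitPoint ξ g = orbitPoint ξ 1 := by
  have h1 : ‖(g : Mat3) 0 0‖ ≤ 1 := SU3.norm_le_one g 0 0
  have h2 : ‖minor₂ g‖ ≤ 1 := SU3.norm_minor₂ g ▸ SU3.norm_le_one g 2 2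
  have h : ‖(g : Mat3) 0 0‖ ^ p * ‖minor₂ g‖ ^ q = 1 :=
    (pow_eq_one_iff_of_nonneg (by positivity) two_ne_zero).1 hg
  have hp1 : ‖(g : Mat3) 0 0‖ ^ p ≤ 1 := pow_le_one₀ (norm_nonneg _) h1
  have hq1 : ‖minor₂ g‖ ^ q ≤ 1 := pow_le_one₀ (norm_nonneg _) h2
  have hp0 : 0 ≤ ‖(g : Mat3) 0 0‖ ^ p := by positivity
  have hq0 : 0 ≤ ‖minor₂ g‖ ^ q := by positivity
  have hp : ‖(g : Mat3) 0 0‖ ^ p = 1 := by nlinarith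
  have hq : ‖minor₂ g‖ ^ q = 1 := by nlinarith
  have hconj := conj_domWeight (p := p) (q := q) g
    (fun h0 => (pow_eq_one_iff_of_nonneg (norm_nonneg _) h0).1 hp)
    (fun h0 => (pow_eq_one_iff_of_nonneg (norm_nonneg _) h0).1 hq)
  have hr' : (r : ℂ) ≠ 0 := by exact_mod_cast hr
  rw [hω, Matrix.mul_smul, Matrix.smul_mul] at hconj
  refine Subtype.ext ?_
  simpa [orbitPoint] using smul_right_injective _ hr' hconj

/-- The multiplicity of an irreducible representation in the functions on the orbit is at most its
multiplicity in the operators, for large representations on the ray of the orbit. -/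
theorem eventually_multiplicity_le [FiniteDimensional ℂ K] {p q : ℕ} {r : ℝ} (hr : r ≠ 0)
    (hω : domWeight p q = (r : ℂ) • ξ)
    {H : ℕ → Type*} [∀ s, NormedAddCommGroup (H s)] [∀ s, InnerProductSpace ℂ (H s)]
    [∀ s, FiniteDimensional ℂ (H s)] (ρ : ∀ s, Representation ℂ SU3 (H s))
    (hρ : ∀ s, 0 < s → IsQuarkSystem (s * p) (s * q) (ρ s))
    (n : ℕ → ℕ) (e : ∀ s, Fin (n s) → K →ₗ[ℂ] Module.End ℂ (H s))
    (he : ∀ s, 0 < s → IsOpDecomposition π (ρ s) (e s))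
    (m : ℕ) (X : Fin m → K →ₗ[ℂ] OrbitPoly ξ) (hX : IsFunDecomposition π X)
    (k : K) (hk : k ≠ 0) : ∀ᶠ s in atTop, m ≤ n s := by
  let b := Module.finBasis ℂ K
  let φ := coherentWeight p q
  let x₀ : Fin m → Fin (Module.finrank ℂ K) → ℂ :=
    fun γ i => (X γ (b i) : orbit ξ → ℂ) (orbitPoint ξ 1)
  let x : ℕ → Fin m → Fin (Module.finrank ℂ K) → ℂ := fun s γ i =>
    (∫ g, (X γ (b i) : orbit ξ → ℂ) (orbitPoint ξ g) * (φ g ^ s : ℝ) ∂haarSU3) /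
      (∫ g, φ g ^ s ∂haarSU3 : ℝ)
  have hlim : Tendsto x atTop (𝓝 x₀) := by
    refine tendsto_pi_nhds.2 fun γ => tendsto_pi_nhds.2 fun i => ?_
    exact tendsto_integral_pow (continuous_coherentWeight p q) (coherentWeight_nonneg p q)
      (coherentWeight_le_one p q) (coherentWeight_one p q)
      (continuous_orbitPoly_orbitPoint (X γ (b i)))
      fun g hg => by rw [orbitPoint_of_coherentWeight hr hω hg]
  -- An equivariant combination of the `X γ` that vanishes at the base point vanishes on the whole
  -- orbit, by transitivity. Orthonormality of the `X γ` then kills its coefficients.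
  have hind : LinearIndependent ℂ x₀ := by
    rw [Fintype.linearIndependent_iff]
    intro c hc
    let T : K →ₗ[ℂ] OrbitPoly ξ := ∑ γ, c γ • X γ
    have hTx : ∀ k y, (T k : orbit ξ → ℂ) y = ∑ γ, c γ * (X γ k : orbit ξ → ℂ) y := by
      intro k y
      simp [T, LinearMap.sum_apply, AddSubmonoidClass.coe_finsetSum, Finset.sum_apply]
    have hTint : IsFunIntertwiner π T := fun g k y => by
      simp only [hTx]
      exact Finset.sum_congr rfl fun γ _ => by rw [hX.intertwines γ g k y]
    have hT1 : ∀ k, (T k : orbit ξ → ℂ) (orbitPoint ξ 1) = 0 := by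
      let L : K →ₗ[ℂ] ℂ := (LinearMap.proj (orbitPoint ξ 1)) ∘ₗ (OrbitPoly ξ).val.toLinearMap ∘ₗ T
      have hL : L = 0 := b.ext fun i => by
        have := congrFun hc i
        simp only [Finset.sum_apply, Pi.smul_apply, smul_eq_mul, Pi.zero_apply] at this
        exact (hTx (b i) _).trans this
      exact fun k => LinearMap.congr_fun hL k
    have hT : T = 0 := by
      refine LinearMap.ext fun k => Subtype.ext (funext fun y => ?_)
      obtain ⟨g, rfl⟩ := orbitPoint_surjective y
      have := hTint g (π g⁻¹ k) (orbitPoint ξ 1)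
      rw [ad_orbitPoint, mul_one, hT1, ← Module.End.mul_apply, ← map_mul, mul_inv_cancel,
        map_one] at this
      exact this
    intro γ
    have h1 := orbitInner_sum_right Finset.univ (X γ k) c fun δ => X δ k
    have h2 : ∑ δ, c δ • X δ k = 0 := by
      have := LinearMap.congr_fun hT k
      simpa [T, LinearMap.sum_apply] using this
    rw [h2] at h1
    simp only [hX.orthonormal, mul_ite, mul_zero, Finset.sum_ite_eq, Finset.mem_univ, if_true] at h1
    have h3 : orbitInner (X γ k) 0 = 0 := by simp [orbitInner, orbitIntegral]
    rw [h3] at h1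
    exact (mul_eq_zero.1 h1.symm).resolve_right (inner_self_ne_zero.2 hk)
  have hev : ∀ᶠ s in atTop, LinearIndependent ℂ (x s) :=
    hlim.eventually (isOpen_setOfPred_linearIndependent.mem_nhds hind)
  filter_upwards [hev, eventually_gt_atTop 0] with s hs hs0
  obtain ⟨v, hv⟩ := (hρ s hs0).weight
  have hcoef : ∀ g, ‖(inner ℂ v (ρ s g v) : ℂ)‖ ^ 2 = φ g ^ s * (‖v‖ ^ 2) ^ 2 := by
    intro g
    rw [inner_highestWeight (hρ s hs0) (by exact_mod_cast hv) g, inner_self_eq_norm_sq_to_K]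
    simp only [norm_mul, norm_pow, RCLike.norm_ofReal, abs_norm, φ, coherentWeight, mul_pow,
      ← pow_mul]
    ring
  let S : Fin m → K →ₗ[ℂ] Module.End ℂ (H s) := fun γ =>
    coherentMap (hρ s hs0).continuous v (X γ)
  have hφI : ((∫ g, φ g ^ s ∂haarSU3 : ℝ) : ℂ) ≠ 0 := by
    have : 0 < ∫ g, φ g ^ s ∂haarSU3 :=
      Continuous.integral_pos_of_hasCompactSupport_nonneg_nonzero
        ((continuous_coherentWeight p q).pow s) (HasCompactSupport.of_compactSpace _)
        (fun g => pow_nonneg (coherentWeight_nonneg p q g) s) (x := 1)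
        (by simp [φ, coherentWeight_one])
    exact_mod_cast this.ne'
  have hSx : ∀ γ i, inner ℂ v (S γ (b i) v) =
      x s γ i * ((∫ g, φ g ^ s ∂haarSU3 : ℝ) * ((‖v‖ ^ 2) ^ 2 : ℝ)) := by
    intro γ i
    simp only [S, x, inner_coherentMap, hcoef]
    rw [← mul_assoc, div_mul_cancel₀ _ hφI, ← integral_mul_const]
    congr 1
    ext g
    push_cast
    ring
  have hSind : LinearIndependent ℂ S := by
    rw [Fintype.linearIndependent_iff] at hs ⊢
    intro c hc
    refine hs c (funext fun i => ?_)
    have h1 : inner ℂ v ((∑ γ, c γ • S γ) (b i) v) = (0 : ℂ) := by rw [hc]; simp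
    have hv0 : (((‖v‖ ^ 2) ^ 2 : ℝ) : ℂ) ≠ 0 := by
      have := norm_ne_zero_iff.2 hv.1
      exact_mod_cast pow_ne_zero _ (pow_ne_zero _ this)
    simp only [LinearMap.sum_apply, LinearMap.smul_apply, inner_sum, inner_smul_right, hSx,
      ← mul_assoc, ← Finset.sum_mul] at h1
    simpa only [Finset.sum_apply, Pi.smul_apply, smul_eq_mul, Pi.zero_apply] using
      (mul_eq_zero.1 ((mul_eq_zero.1 h1).resolve_right hv0)).resolve_right hφI
  have hspan : Set.range S ⊆ Submodule.span ℂ (Set.range (e s)) := by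
    rintro _ ⟨γ, rfl⟩
    exact (he s hs0).complete _ (isOpIntertwiner_coherentMap (hρ s hs0).unitary _ v
      (hX.intertwines γ))
  classical
  have := linearIndependent_le_span_aux' S hSind (Set.range (e s)) hspan
  simpa using this.trans (Fintype.card_range_le (e s))

end Multiplicity

/-! ### Characteristic matrices -/

section MatrixNorm

open scoped Matrix.Norms.L2Operator

variable {m n : Type*} [Fintype m] [Fintype n] [DecidableEq n]

theorem norm_entry_le_l2_opNorm (A : Matrix m n ℂ) (i : m) (j : n) : ‖A i j‖ ≤ ‖A‖ := by
  have h1 := Matrix.l2_opNorm_mulVec A (EuclideanSpace.single j 1)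
  have h2 := PiLp.norm_apply_le (WithLp.toLp 2 (A *ᵥ (EuclideanSpace.single j (1 : ℂ)).ofLp)) i
  rw [show ‖EuclideanSpace.single j (1 : ℂ)‖ = 1 by simp, mul_one] at h1
  refine le_trans (le_of_eq ?_) (h2.trans h1)
  simp

variable [DecidableEq m]

/-- If `Cᴴ G C = 1` with `G` close to the identity, then `Cᴴ C` is close to the identity. -/
theorem norm_conjTranspose_mul_self_sub_one_le {C : Matrix m n ℂ} {G : Matrix m m ℂ}
    (h : Cᴴ * G * C = 1) {δ : ℝ} (hδ : δ < 1) (hG : ‖G - 1‖ ≤ δ) (i j : n) :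
    ‖(Cᴴ * C - 1 : Matrix n n ℂ) i j‖ ≤ δ / (1 - δ) := by
  refine (norm_entry_le_l2_opNorm _ i j).trans ?_
  have hδ0 : 0 ≤ δ := (norm_nonneg _).trans hG
  -- With `x = ‖Cᴴ C - 1‖`, this identity gives `x ≤ ‖Cᴴ C‖ δ ≤ (x + 1) δ`, so no a priori bound on
  -- `C` is needed.
  have e : Cᴴ * C - 1 = -(Cᴴ * (G - 1) * C) := by
    rw [Matrix.mul_sub, Matrix.sub_mul, h, Matrix.mul_one]
    abel
  have h1 : ‖Cᴴ * C - 1‖ ≤ ‖Cᴴ * C‖ * δ := by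
    rw [e, norm_neg, Matrix.l2_opNorm_conjTranspose_mul_self]
    calc ‖Cᴴ * (G - 1) * C‖ ≤ ‖Cᴴ‖ * ‖G - 1‖ * ‖C‖ :=
          (Matrix.l2_opNorm_mul _ _).trans
            (mul_le_mul_of_nonneg_right (Matrix.l2_opNorm_mul _ _) (norm_nonneg _))
      _ ≤ ‖C‖ * δ * ‖C‖ := by
          rw [Matrix.l2_opNorm_conjTranspose]
          gcongr
      _ = ‖C‖ * ‖C‖ * δ := by ring
  have h2 : ‖Cᴴ * C‖ ≤ ‖Cᴴ * C - 1‖ + 1 := by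
    have hone : ‖(1 : Matrix n n ℂ)‖ ≤ 1 := by
      rw [← Matrix.diagonal_one, Matrix.l2_opNorm_diagonal]
      exact (pi_norm_le_iff_of_nonneg zero_le_one).2 fun _ => by simp
    calc ‖Cᴴ * C‖ = ‖(Cᴴ * C - 1) + 1‖ := by rw [sub_add_cancel]
      _ ≤ _ := (norm_add_le _ _).trans (by gcongr)
  rw [le_div_iff₀ (by linarith)]
  nlinarith [mul_le_mul_of_nonneg_right h2 hδ0]

theorem eventually_conjTranspose_mul_self {ν : ℕ → ℕ} {C : ∀ s, Matrix m (Fin (ν s)) ℂ}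
    {G : ℕ → Matrix m m ℂ} (h : ∀ᶠ s in atTop, (C s)ᴴ * G s * C s = 1)
    (hG : ∀ i j, Tendsto (fun s => G s i j) atTop (𝓝 ((1 : Matrix m m ℂ) i j))) {ε : ℝ}
    (hε : 0 < ε) : ∀ᶠ s in atTop, ∀ i j : Fin (ν s),
      ‖((C s)ᴴ * C s - 1 : Matrix (Fin (ν s)) (Fin (ν s)) ℂ) i j‖ < ε := by
  have hlim : Tendsto G atTop (𝓝 1) := tendsto_pi_nhds.2 fun i => tendsto_pi_nhds.2 (hG i)
  -- With `δ = ε / (2 + 2ε)` the bound `δ / (1 - δ)` equals `ε / (2 + ε) < ε`.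
  have hnorm := (tendsto_iff_norm_sub_tendsto_zero.1 hlim).eventually_lt_const
    (show 0 < ε / (2 + 2 * ε) by positivity)
  filter_upwards [h, hnorm] with s hs hs' i j
  have hlt : ε / (2 + 2 * ε) < 1 := by
    rw [div_lt_one (by positivity)]
    linarith
  refine (norm_conjTranspose_mul_self_sub_one_le hs hlt hs'.le i j).trans_lt ?_
  have h1 : 1 - ε / (2 + 2 * ε) = (2 + ε) / (2 + 2 * ε) := by
    field_simp
    ring
  rw [h1, div_div_div_cancel_right₀ (by positivity), div_lt_iff₀ (by positivity)]
  nlinarith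

end MatrixNorm

/-! ### Symbols of the isotypic components -/

section Symbols

variable {ξ : Mat3} {K : Type*} [NormedAddCommGroup K] [InnerProductSpace ℂ K]
  {π : Representation ℂ SU3 K} {H : Type*} [NormedAddCommGroup H] [InnerProductSpace ℂ H]
  [FiniteDimensional ℂ H] {ρ : Representation ℂ SU3 H}

theorem hsInner_sum_sum {ι κ : Type*} (s : Finset ι) (t : Finset κ) (c : ι → ℂ) (d : κ → ℂ)
    (A : ι → Module.End ℂ H) (B : κ → Module.End ℂ H) :
    hsInner (∑ i ∈ s, c i • A i) (∑ j ∈ t, d j • B j) =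
      ∑ i ∈ s, ∑ j ∈ t, starRingEnd ℂ (c i) * d j * hsInner (A i) (B j) := by
  simp only [hsInner, map_sum, map_smulₛₗ, Finset.sum_mul_sum, smul_mul_assoc, mul_smul_comm,
    smul_eq_mul, RingHom.id_apply]
  exact Finset.sum_congr rfl fun i _ => Finset.sum_congr rfl fun j _ => by ring

/-- The columns of the characteristic matrix are the coefficients of the symbols. -/
theorem symbol_eq_sum_charMatrix {W : Module.End ℂ H →ₗ[ℂ] OrbitPoly ξ}
    (hW : IsSymbolCorrespondence ρ W) {n m : ℕ} {e : Fin n → K →ₗ[ℂ] Module.End ℂ H}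
    (he : IsOpDecomposition π ρ e) {X : Fin m → K →ₗ[ℂ] OrbitPoly ξ}
    (hX : IsFunDecomposition π X) {k : K} (hk : ‖k‖ = 1) (σ : Fin n) :
    W (((√(Module.finrank ℂ H : ℝ) : ℝ) : ℂ) • e σ k) =
      ∑ γ, charMatrix W e X k γ σ • X γ k := by
  set d : ℂ := ((√(Module.finrank ℂ H : ℝ) : ℝ) : ℂ) with hd
  let T : K →ₗ[ℂ] OrbitPoly ξ := W ∘ₗ (d • e σ)
  have hT : IsFunIntertwiner π T := fun g k x => by
    refine Eq.trans ?_ (hW.equivariant g (d • e σ k) x)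
    simp only [T, LinearMap.comp_apply, LinearMap.smul_apply, he.intertwines σ g k,
      mul_smul_comm, smul_mul_assoc]
  obtain ⟨c, hc⟩ := Submodule.mem_span_range_iff_exists_fun ℂ |>.1 (hX.complete T hT)
  have hTk : W (d • e σ k) = ∑ γ, c γ • X γ k := by
    have := LinearMap.congr_fun hc k
    simpa [T, LinearMap.sum_apply] using this.symm
  rw [hTk]
  refine Finset.sum_congr rfl fun γ _ => ?_
  congr 1
  rw [charMatrix, Matrix.of_apply, ← hd, hTk, orbitInner_sum_right]
  simp [hX.orthonormal, inner_self_eq_norm_sq_to_K, hk]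

/-- A kernel vector is a combination of the operators `e σ k` with zero symbol. Injectivity of `W`
makes the combination zero, and pairing with each `e τ k` recovers its coefficients. -/
theorem charMatrix_mulVec_injective [Nontrivial H] {W : Module.End ℂ H →ₗ[ℂ] OrbitPoly ξ}
    (hW : IsSymbolCorrespondence ρ W) {n m : ℕ} {e : Fin n → K →ₗ[ℂ] Module.End ℂ H}
    (he : IsOpDecomposition π ρ e) {X : Fin m → K →ₗ[ℂ] OrbitPoly ξ}
    (hX : IsFunDecomposition π X) {k : K} (hk : ‖k‖ = 1) :
    Function.Injective (charMatrix W e X k).mulVec := by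
  have hd : ((√(Module.finrank ℂ H : ℝ) : ℝ) : ℂ) ≠ 0 := by
    have : 0 < Module.finrank ℂ H := Module.finrank_pos
    have : (0 : ℝ) < √(Module.finrank ℂ H : ℝ) := Real.sqrt_pos.2 (by exact_mod_cast this)
    exact_mod_cast this.ne'
  refine (injective_iff_map_eq_zero (charMatrix W e X k).mulVecLin).2 fun y hy => ?_
  have hW0 : W (∑ σ, y σ • ((√(Module.finrank ℂ H : ℝ) : ℝ) : ℂ) • e σ k) = 0 := by
    simp only [map_sum, map_smul _ (y _), symbol_eq_sum_charMatrix hW he hX hk, Finset.smul_sum]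
    rw [Finset.sum_comm]
    refine Finset.sum_eq_zero fun γ _ => ?_
    have h0 : ∑ σ, charMatrix W e X k γ σ * y σ = 0 := congrFun hy γ
    simp only [smul_smul, ← Finset.sum_smul, mul_comm (y _), h0, zero_smul]
  have h0 := (map_eq_zero_iff W hW.injective).1 hW0
  ext τ
  have h1 := hsInner_sum_sum {()} Finset.univ (fun _ => 1)
    (fun σ => y σ * ((√(Module.finrank ℂ H : ℝ) : ℝ) : ℂ)) (fun _ : Unit => e τ k) fun σ => e σ k
  simp only [smul_smul] at h0
  rw [h0] at h1
  have h2 : hsInner (∑ _ ∈ {()}, (1 : ℂ) • e τ k) 0 = 0 := by simp [hsInner]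
  rw [h2] at h1
  simp only [Finset.sum_singleton, he.orthonormal, mul_ite, mul_zero, Finset.sum_ite_eq,
    Finset.mem_univ, if_true, map_one, one_mul, inner_self_eq_norm_sq_to_K, hk] at h1
  simpa [hd] using h1.symm

/-- When the multiplicities agree, the harmonic functions are symbols of operators whose Gram
matrix is inverse to the characteristic matrix. -/
theorem exists_symbol_preimages [Nontrivial H] {W : Module.End ℂ H →ₗ[ℂ] OrbitPoly ξ}
    (hW : IsSymbolCorrespondence ρ W) {n m : ℕ} (hnm : n = m)
    {e : Fin n → K →ₗ[ℂ] Module.End ℂ H}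
    (he : IsOpDecomposition π ρ e) {X : Fin m → K →ₗ[ℂ] OrbitPoly ξ}
    (hX : IsFunDecomposition π X) {k : K} (hk : ‖k‖ = 1) :
    ∃ A : Fin m → Module.End ℂ H, (∀ γ, W (A γ) = X γ k) ∧
      (charMatrix W e X k)ᴴ *
        (Matrix.of fun γ δ => hsInner (A γ) (A δ) / (Module.finrank ℂ H : ℂ)) *
          charMatrix W e X k = 1 := by
  subst hnm
  set C := charMatrix W e X k with hC
  set d : ℂ := ((√(Module.finrank ℂ H : ℝ) : ℝ) : ℂ) with hd
  have hdd : d * d = (Module.finrank ℂ H : ℂ) := by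
    rw [hd, ← Complex.ofReal_mul, Real.mul_self_sqrt (Nat.cast_nonneg _), Complex.ofReal_natCast]
  have hd0 : (Module.finrank ℂ H : ℂ) ≠ 0 := by
    exact_mod_cast (Module.finrank_pos : 0 < Module.finrank ℂ H).ne'
  have hdet : IsUnit C.det := (Matrix.isUnit_iff_isUnit_det C).1
    (Matrix.mulVec_injective_iff_isUnit.1 (charMatrix_mulVec_injective hW he hX hk))
  have hCD := Matrix.mul_nonsing_inv C hdet
  have hDC := Matrix.nonsing_inv_mul C hdet
  set D := C⁻¹
  refine ⟨fun γ => ∑ σ, (D σ γ * d) • e σ k, fun γ => ?_, ?_⟩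
  · simp only [mul_smul, map_sum, map_smul _ (D _ _), hd, symbol_eq_sum_charMatrix hW he hX hk,
      Finset.smul_sum]
    rw [Finset.sum_comm, ← hC]
    have h0 : ∀ δ, ∑ σ, C δ σ * D σ γ = (1 : Matrix (Fin n) (Fin n) ℂ) δ γ := fun δ => by
      rw [← hCD, Matrix.mul_apply]
    simp only [smul_smul, ← Finset.sum_smul, mul_comm (D _ _), h0]
    simp [Matrix.one_apply]
  · have hG : (Matrix.of fun γ δ => hsInner (∑ σ, (D σ γ * d) • e σ k)
        (∑ σ, (D σ δ * d) • e σ k) / (Module.finrank ℂ H : ℂ)) = Dᴴ * D := by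
      ext γ δ
      rw [Matrix.of_apply, hsInner_sum_sum, div_eq_iff hd0, Matrix.mul_apply, Finset.sum_mul]
      refine Finset.sum_congr rfl fun σ _ => ?_
      simp only [he.orthonormal, mul_ite, mul_zero, Finset.sum_ite_eq, Finset.mem_univ, if_true,
        inner_self_eq_norm_sq_to_K, hk, map_mul]
      have hdc : starRingEnd ℂ d = d := Complex.conj_ofReal _
      rw [hdc, Matrix.conjTranspose_apply, ← hdd, Complex.star_def]
      simp
      ring
    rw [hG, ← Matrix.mul_assoc, ← Matrix.conjTranspose_mul, hDC, Matrix.conjTranspose_one,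
      Matrix.one_mul, hDC]

end Symbols

end

end QuarkSystems

/-! ### The main theorem -/

open QuarkSystems
theorem theorem3p15 {ξ : Mat3} (hξ : ξ ∈ rationalPoints)
    (p₁ q₁ : ℕ) (hω : domWeight p₁ q₁ = (intRadius ξ : ℂ) • ξ)
    {H : ℕ → Type*} [∀ s, NormedAddCommGroup (H s)] [∀ s, InnerProductSpace ℂ (H s)]
    [∀ s, FiniteDimensional ℂ (H s)]
    (ρ : ∀ s, Representation ℂ SU3 (H s))
    (hρ : ∀ s, 0 < s → IsQuarkSystem (s * p₁) (s * q₁) (ρ s))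
    (W : ∀ s, Module.End ℂ (H s) →ₗ[ℂ] OrbitPoly ξ)
    (hW : ∀ s, 0 < s → IsSymbolCorrespondence (ρ s) (W s))
    (hP : IsPoissonType ξ W)
    (a b : ℕ) {K : Type*} [NormedAddCommGroup K] [InnerProductSpace ℂ K]
    [FiniteDimensional ℂ K]
    (π : Representation ℂ SU3 K) (hπ : IsQuarkSystem a b π)
    (n : ℕ → ℕ) (e : ∀ s, Fin (n s) → K →ₗ[ℂ] Module.End ℂ (H s))
    (he : ∀ s, 0 < s → IsOpDecomposition π (ρ s) (e s))
    (m : ℕ) (X : Fin m → K →ₗ[ℂ] OrbitPoly ξ) (hX : IsFunDecomposition π X)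
    (k : K) (hk : ‖k‖ = 1) :
    (∀ᶠ s in atTop, n s = m) ∧
    ∀ ε > 0, ∀ᶠ s in atTop, ∀ i j : Fin (n s),
      ‖((charMatrix (W s) (e s) X k)ᴴ * charMatrix (W s) (e s) X k - 1 :
        Matrix (Fin (n s)) (Fin (n s)) ℂ) i j‖ < ε := by
  have hnt : ∀ s, 0 < s → Nontrivial (H s) := fun s hs =>
    let ⟨v, hv⟩ := (hρ s hs).weight
    ⟨v, 0, hv.1⟩
  have hnm : ∀ᶠ s in atTop, n s = m := by
    have hk0 : k ≠ 0 := by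
      rintro rfl
      simp at hk
    filter_upwards [eventually_gt_atTop 0, eventually_multiplicity_le (intRadius_pos hξ).ne' hω ρ
      hρ n e he m X hX k hk0] with s hs hle
    have := hnt s hs
    refine le_antisymm ?_ hle
    simpa using LinearMap.finrank_le_finrank_of_injective
      (f := (charMatrix (W s) (e s) X k).mulVecLin)
      (charMatrix_mulVec_injective (hW s hs) (he s hs) hX hk)
  refine ⟨hnm, fun ε hε => ?_⟩
  have hgram : ∀ᶠ s in atTop, 0 < s ∧ ∃ A : Fin m → Module.End ℂ (H s),
      (∀ γ, W s (A γ) = X γ k) ∧ (charMatrix (W s) (e s) X k)ᴴ *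
        (Matrix.of fun γ δ => hsInner (A γ) (A δ) / (Module.finrank ℂ (H s) : ℂ)) *
          charMatrix (W s) (e s) X k = 1 := by
    filter_upwards [eventually_gt_atTop 0, hnm] with s hs hs'
    have := hnt s hs
    exact ⟨hs, exists_symbol_preimages (hW s hs) hs' (he s hs) hX hk⟩
  -- The conjugates of the harmonic functions are polynomial, being symbols of adjoints at a single
  -- large level. They must be fixed independently of `s` for the limit of twisted products.
  obtain ⟨f, hf⟩ : ∃ f : Fin m → OrbitPoly ξ, ∀ γ x,
      (f γ : orbit ξ → ℂ) x = starRingEnd ℂ ((X γ k : orbit ξ → ℂ) x) := by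
    obtain ⟨s, hs, A, hA, -⟩ := hgram.exists
    exact ⟨fun γ => W s (LinearMap.adjoint (A γ)), fun γ x => by rw [(hW s hs).real, hA]⟩
  let G : ℕ → Matrix (Fin m) (Fin m) ℂ := fun s => Matrix.of fun γ δ =>
    orbitIntegral (twisted (W s) (f γ) (X δ k) : orbit ξ → ℂ)
  refine eventually_conjTranspose_mul_self (G := G) ?_ (fun γ δ => ?_) hε
  · filter_upwards [hgram] with s hs
    obtain ⟨hs, A, hA, hC⟩ := hs
    have hinv := Function.leftInverse_invFun (hW s hs).injective
    have hfA : ∀ γ, W s (LinearMap.adjoint (A γ)) = f γ := fun γ =>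
      Subtype.ext (funext fun x => by rw [(hW s hs).real, hA, hf])
    convert hC using 3
    ext γ δ
    simp only [G, Matrix.of_apply, twisted]
    rw [← hfA γ, ← hA δ, hinv, hinv, (hW s hs).normalized]
    rfl
  · rw [tendsto_iff_norm_sub_tendsto_zero]
    -- The invariant measure has mass one, so integrals are controlled by the supremum norm.
    refine squeeze_zero (fun _ => norm_nonneg _) (fun s => ?_) (hP.product (f γ) (X δ k))
    have h1 : orbitIntegral ((f γ * X δ k : OrbitPoly ξ) : orbit ξ → ℂ) =
        (1 : Matrix (Fin m) (Fin m) ℂ) γ δ := by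
      have h2 := hX.orthonormal γ δ k k
      rw [inner_self_eq_norm_sq_to_K, hk] at h2
      simp only [orbitInner, ← hf] at h2
      rw [Matrix.one_apply]
      exact h2.trans (by simp)
    rw [← h1]
    simp only [G, Matrix.of_apply]
    rw [← orbitIntegral_sub]
    exact norm_orbitIntegral_le _
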